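/- Let $K$ be an algebraically closed field, complete with respect to a nontrivial nonarchimedean absolute value $|\cdot|$. Let $\Delta=\{z\in K:|z|<1\}$, and let $H^\infty$ be the algebra of bounded analytic functions on $\Delta$, that is, of the bounded functions $f:\Delta\to K$ that are the sum on $\Delta$ of a power series $\sum_{n\ge 0}a_nz^n$, with the norm $\|f\|=\sup_{z\in\Delta}|f(z)|$. The Berkovich space $\mathcal M(H^\infty)$ is the set of all multiplicative ring seminorms $\varphi$ on $H^\infty$ with $\varphi(f)\le\|f\|$ for all $f$; the kernel of $\varphi$ is the ideal $\ker\varphi=\{f:\varphi(f)=0\}$. A point of $\mathcal M(H^\infty)$ is of type IV if its kernel is a nonzero nonmaximal prime ideal. For a closed disk $D=D^+(z,r)$ with $z\in\Delta$, $r\in(0,1)$, put $\zeta_D(f)=\sup_{w\in D}|f(w)|$. Let $\mathcal M_0\subset\mathcal M(H^\infty)$ be the set of all limits $\varphi=\lim_{\mathcal F}\zeta_{D^+(z_n,r_n)}$ (so $\varphi(f)=\lim_{\mathcal F}\zeta_{D^+(z_n,r_n)}(f)$ for every $f$), where $\mathcal F$ is a nonprincipal ultrafilter on $\mathbb N$,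 $(z_n)$ is a sequence in $\Delta$ with $\lim_{n\to\infty}|z_n|=1$, and $(r_n)$ is a sequence in $(0,1)$. Let $\mathcal M_1\subset\mathcal M_0$ be the set of those limits that can be so written with $(z_n)$ regular with respect to $\mathcal F$, i.e. $\inf_{n\in C}\prod_{m\in C,\,m\ne n}|z_n-z_m|>0$ for some $C\in\mathcal F$, and with the disks $D^+(z_n,r_n)$, $n\in C'$, pairwise disjoint for some $C'\in\mathcal F$. **Theorem.** Let $\varphi\in\mathcal M_0$ have nonzero kernel. 1. For every nonzero $f\in\ker\varphi$ and every $r\in(0,\|f\|)$ there exists $\psi\in\mathcal M_1$ of type IV such that $\varphi\le\psi$ pointwise on $H^\infty$ and $\psi(f)=r$; moreover $\ker\psi\subsetneq\ker\varphi$. 2. There is a sequence $(\psi_n)_{n\ge0}$ in $\mathcal M(H^\infty)$ with $\psi_0=\varphi$ and $\ker\psi_0\supsetneq\ker\psi_1\supsetneq\ker\psi_2\supsetneq\cdots$, where $\psi_n\in\mathcal M_1$ is of type IV for every $n\ge1$. Consequently $\mathcal M(H^\infty)$ contains points of type IV, and there is a sequence in $\mathcal M(H^\infty)$ whose kernels form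 an infinite strictly decreasing chain. -/

import Mathlib

open Filter Topology

noncomputable section

namespace HInfBerkovich

/-- The open unit disk `Δ = {z ∈ K : |z| < 1}`, as a type. -/
abbrev Disk (K : Type*) [NontriviallyNormedField K] : Type _ := Metric.ball (0 : K) 1

/-- `f : Δ → K` is analytic on the disk: it is the sum of one power series on all of `Δ`. -/
def IsAnalyticOnDisk {K : Type*} [NontriviallyNormedField K] (f : Disk K → K) : Prop :=
  ∃ a : ℕ → K, ∀ z : Disk K, HasSum (fun n => a n * (z : K) ^ n) (f z)

/-- `f : Δ → K` is bounded. -/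
def IsBoundedOnDisk {K : Type*} [NontriviallyNormedField K] (f : Disk K → K) : Prop :=
  ∃ C : ℝ, ∀ z : Disk K, ‖f z‖ ≤ C

theorem nonarchimedeanRing (K : Type*) [NontriviallyNormedField K] [IsUltrametricDist K] :
    NonarchimedeanRing K :=
  { is_nonarchimedean := NonarchimedeanAddGroup.is_nonarchimedean }

theorem hasSum_cauchyProduct {K : Type*} [NontriviallyNormedField K] [IsUltrametricDist K]
    {u v : ℕ → K} {s t : K} (hu : HasSum u s) (hv : HasSum v t) :
    HasSum (fun n => ∑ k ∈ Finset.range (n + 1), u k * v (n - k)) (s * t) := by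
  have := nonarchimedeanRing K
  have hs : Summable fun x : ℕ × ℕ => u x.1 * v x.2 :=
    hu.summable.mul_of_nonarchimedean hv.summable
  have h1 := summable_sum_mul_range_of_summable_mul hs
  have h2 := hu.summable.tsum_mul_tsum_eq_tsum_sum_range hv.summable hs
  rw [hu.tsum_eq, hv.tsum_eq] at h2
  rw [h2]
  exact h1.hasSum

theorem IsAnalyticOnDisk.mul {K : Type*} [NontriviallyNormedField K] [IsUltrametricDist K]
    {f g : Disk K → K}
    (hf : IsAnalyticOnDisk f) (hg : IsAnalyticOnDisk g) : IsAnalyticOnDisk (f * g) := by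
  obtain ⟨a, ha⟩ := hf
  obtain ⟨b, hb⟩ := hg
  refine ⟨fun n => ∑ k ∈ Finset.range (n + 1), a k * b (n - k), fun z => ?_⟩
  have h3 := hasSum_cauchyProduct (ha z) (hb z)
  have h4 : ∀ n : ℕ, ∑ k ∈ Finset.range (n + 1),
      (a k * (z : K) ^ k) * (b (n - k) * (z : K) ^ (n - k)) =
      (∑ k ∈ Finset.range (n + 1), a k * b (n - k)) * (z : K) ^ n := by
    intro n
    rw [Finset.sum_mul]
    refine Finset.sum_congr rfl fun k hk => ?_
    have hkn : k + (n - k) = n := by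
      have := Finset.mem_range.1 hk
      omega
    calc a k * (z : K) ^ k * (b (n - k) * (z : K) ^ (n - k))
        = a k * b (n - k) * (z : K) ^ (k + (n - k)) := by rw [pow_add]; ring
      _ = a k * b (n - k) * (z : K) ^ n := by rw [hkn]
  simp only [h4] at h3
  exact h3

/-- The algebra `H^∞` of bounded analytic functions on the open unit disk, with pointwise
operations. -/
def HInf (K : Type*) [NontriviallyNormedField K] [IsUltrametricDist K] :
    Subalgebra K (Disk K → K) where
  carrier := {f | IsAnalyticOnDisk f ∧ IsBoundedOnDisk f}
  mul_mem' := by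
    rintro f g ⟨hf, C, hC⟩ ⟨hg, D, hD⟩
    refine ⟨hf.mul hg, C * D, fun z => ?_⟩
    rw [Pi.mul_apply, norm_mul]
    exact mul_le_mul (hC z) (hD z) (norm_nonneg _) ((norm_nonneg _).trans (hC z))
  add_mem' := by
    rintro f g ⟨⟨a, ha⟩, C, hC⟩ ⟨⟨b, hb⟩, D, hD⟩
    refine ⟨⟨fun n => a n + b n, fun z => ?_⟩, C + D, fun z => ?_⟩
    · simpa only [add_mul, Pi.add_apply] using (ha z).add (hb z)
    · exact (norm_add_le _ _).trans (add_le_add (hC z) (hD z))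
  algebraMap_mem' := by
    intro c
    refine ⟨⟨fun n => if n = 0 then c else 0, fun z => ?_⟩, ‖c‖, fun z => le_rfl⟩
    have h := hasSum_single (f := fun n : ℕ => (if n = 0 then c else 0) * (z : K) ^ n) 0
      (fun n hn => by simp [hn])
    simpa using h

section

variable {K : Type*} [NontriviallyNormedField K] [IsUltrametricDist K]

/-- The sup norm `‖f‖ = sup_{z ∈ Δ} |f(z)|`. -/
def supNorm (f : HInf K) : ℝ := ⨆ z : Disk K, ‖f.1 z‖

/-- `ζ_D(f) = sup_{w ∈ D} |f(w)|` for the closed disk `D = D⁺(c, r)` with `c ∈ Δ`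
(a closed ball of the metric space `Δ`). -/
def diskSup (c : Disk K) (r : ℝ) (f : HInf K) : ℝ :=
  ⨆ w : Metric.closedBall c r, ‖f.1 w.1‖

variable (K) in
/-- The Berkovich space of `H^∞`: the multiplicative ring seminorms that are bounded by the
sup norm. -/
structure Berkovich extends MulRingSeminorm (HInf K) where
  le_supNorm' : ∀ f : HInf K, toFun f ≤ supNorm f

instance : FunLike (Berkovich K) (HInf K) ℝ where
  coe φ := φ.toMulRingSeminorm
  coe_injective := by
    rintro ⟨φ, _⟩ ⟨ψ, _⟩ h
    have h' : φ = ψ := DFunLike.coe_injective h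
    subst h'
    rfl

/-- The kernel `{f : φ(f) = 0}`, as an ideal of `H^∞`. -/
def Berkovich.ker (φ : Berkovich K) : Ideal (HInf K) where
  carrier := {f | φ f = 0}
  zero_mem' := map_zero φ.toMulRingSeminorm
  add_mem' := by
    intro f g hf hg
    have h1 : φ.toMulRingSeminorm f = 0 := hf
    have h2 : φ.toMulRingSeminorm g = 0 := hg
    have h3 := map_add_le_add φ.toMulRingSeminorm f g
    rw [h1, h2, add_zero] at h3
    exact le_antisymm h3 (apply_nonneg φ.toMulRingSeminorm (f + g))
  smul_mem' := by
    intro c f hf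
    have h1 : φ.toMulRingSeminorm f = 0 := hf
    have h2 := map_mul φ.toMulRingSeminorm c f
    rw [h1, mul_zero] at h2
    exact h2

/-- A point of type IV: its kernel is a nonzero nonmaximal prime ideal. -/
def Berkovich.IsTypeIV (φ : Berkovich K) : Prop :=
  φ.ker.IsPrime ∧ φ.ker ≠ ⊥ ∧ ¬ φ.ker.IsMaximal

/-- A nonprincipal ultrafilter on `ℕ`. -/
def Nonprincipal (F : Ultrafilter ℕ) : Prop := ∀ n : ℕ, F ≠ pure n

/-- `φ = lim_F ζ_{D⁺(z_n, r_n)}`, where `F` is nonprincipal, `|z_n| → 1` and `r_n ∈ (0,1)`. -/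
def IsDiskLimit (φ : Berkovich K) (F : Ultrafilter ℕ) (z : ℕ → Disk K) (r : ℕ → ℝ) : Prop :=
  Nonprincipal F ∧ Tendsto (fun n => ‖(z n : K)‖) atTop (𝓝 1) ∧
    (∀ n, r n ∈ Set.Ioo (0 : ℝ) 1) ∧
    ∀ f : HInf K, Tendsto (fun n => diskSup (z n) (r n) f) (F : Filter ℕ) (𝓝 (φ f))

/-- `(z_n)` is regular with respect to `F`:
`inf_{n ∈ C} ∏_{m ∈ C, m ≠ n} |z_n - z_m| > 0` for some `C ∈ F`. (The factors lie in `[0,1)`, so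
the product always converges, possibly to `0`.) -/
def IsRegular (F : Ultrafilter ℕ) (z : ℕ → Disk K) : Prop :=
  ∃ C ∈ F, 0 < ⨅ n : C, ∏' m : {m : ℕ // m ∈ C ∧ m ≠ n}, ‖(z n : K) - (z m : K)‖

variable (K) in
/-- The set `M₀` of all limits `lim_F ζ_{D⁺(z_n, r_n)}` with `|z_n| → 1`. -/
def M₀ : Set (Berkovich K) := {φ | ∃ F z r, IsDiskLimit φ F z r}

variable (K) in
/-- The set `M₁` of those limits for which `(z_n)` is regular with respect to `F` and the disks
`D⁺(z_n, r_n)`, `n ∈ C`, are pairwise disjoint for some `C ∈ F`. -/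
def M₁ : Set (Berkovich K) :=
  {φ | ∃ F z r, IsDiskLimit φ F z r ∧ IsRegular F z ∧
    ∃ C ∈ F, C.PairwiseDisjoint fun n => Metric.closedBall (z n) (r n)}

end

end HInfBerkovich

end

open HInfBerkovich

/-!
Everything rests on one formula: for a polynomial `p = c ∏ (X - w)` over an algebraically closed `K`,
the supremum of `|p|` on `D⁺(a, t)` is `|c| ∏ max t |a - w|` (`rootSup`). As the Taylor polynomials
of `f` converge uniformly to `f` on smaller disks, this shows that `ζ_D` is multiplicative
(`diskSup_mul`) and continuous in the radius, and that Taylor coefficients are bounded by the sup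
norm. So `H^∞` is the ring of power series with bounded coefficients (`toPS`, `exists_toPS_eq`).

*The point `ψ` above `φ`.* Let `φ = lim ζ_{D⁺(zₙ, rₙ)}` kill `f`, and let `0 < ρ < ‖f‖`. Let `Tₙ` be
the largest radius with `ζ_{D⁺(zₙ, Tₙ)}(f) = ρ` (`exists_maximal_radius`), and let `ψ` be the limit
over these larger disks. By maximality two of them are equal or disjoint, so after passing to one
index for each disk they are disjoint. Each holds a root of a polynomial `p` close to `f`, because
`ζ(p)` grows between the radii `rₙ` and `Tₙ`; comparing `ρ = ζ_{D⁺(zₙ, Tₙ)}(p)` with the root formula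
gives `∏ |zₙ - zₘ| ≥ ρ / ‖f‖` over any finite set of other indices (`le_supNorm_mul_prod`), which is
regularity. Thus `ψ ∈ M₁` (`exists_mem_M₁_of_isDiskLimit`).

*The kernel of `ψ` is nonzero.* This uses only `ψ(f) < ‖f‖` and `ψ(z - w) = 1` for all `w` in the
disk (`ker_ne_bot_of_lt_supNorm`). For `s < 1`, division of `f` by the roots in `|w| ≤ s` of a Taylor
polynomial gives `f = P u + R` with `P` monic, `R` small and `u` without zeros in `|z| ≤ s`. Then
`ψ(P) = 1`, so `ψ(u)` is about `ψ(f)`, while `|u(0)|` and `‖u‖` are both close to `‖f‖` for `s` close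
to `1`. After normalizing to `u(0) = 1` and multiplying by a Taylor polynomial of `1 / u`, one
gets for each `l` a function `G = 1 + O(z^l)` with `‖G‖` as close to `1` as desired and `ψ(G) ≤ L`
for a fixed `L < 1` (`exists_factor`). The product `g` of such functions converges coefficientwise
with all tails bounded by `2` (`exists_infinite_prod`), so `g ≠ 0` and `ψ(g) ≤ 2 L^J` for all `J`.

Since `ker ψ` is nonzero and strictly inside the proper ideal `ker φ`, the point `ψ` has type IV, and
repeating the construction gives the chain. A first point of `M₀` with nonzero kernel comes from
shrinking disks around the zeros `wⱼ` of `∏ (1 - (z / wⱼ)^(j+1))` (`exists_mem_M₀_ker_ne_bot`).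
-/

open Filter Topology

noncomputable section

namespace HInfBerkovich

set_option linter.unusedSectionVars false

open Polynomial

/-! ### Polynomials on closed disks -/

section PolynomialDisk

variable {K : Type*} [NontriviallyNormedField K] [IsUltrametricDist K]

theorem norm_sub_le_max' (x y : K) : ‖x - y‖ ≤ max ‖x‖ ‖y‖ := by
  simpa [sub_eq_add_neg] using IsUltrametricDist.norm_add_le_max x (-y)

variable [IsAlgClosed K]

theorem norm_eval_eq_prod (p : K[X]) (x : K) :
    ‖p.eval x‖ = ‖p.leadingCoeff‖ * (p.roots.map fun w => ‖x - w‖).prod := by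
  rw [(IsAlgClosed.splits p).eval_eq_prod_roots x, norm_mul]
  congr 1
  induction p.roots using Multiset.induction with
  | empty => simp
  | cons a s ih => simp [ih]

/-- The supremum of `|p|` on the closed disk `D⁺(c, t)`, `t > 0`, in terms of the roots of `p`. -/
def rootSup (p : K[X]) (c : K) (t : ℝ) : ℝ :=
  ‖p.leadingCoeff‖ * (p.roots.map fun w => max t ‖c - w‖).prod

theorem norm_eval_le_rootSup (p : K[X]) {c x : K} {t : ℝ} (hx : ‖x - c‖ ≤ t) :
    ‖p.eval x‖ ≤ rootSup p c t := by
  rw [norm_eval_eq_prod]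
  refine mul_le_mul_of_nonneg_left (Multiset.prod_map_le_prod_map₀ _ _ (fun _ _ => norm_nonneg _)
    fun w _ => ?_) (norm_nonneg _)
  have : x - w = (x - c) + (c - w) := by ring
  rw [this]
  exact (IsUltrametricDist.norm_add_le_max _ _).trans (max_le_max_right _ hx)

theorem continuous_rootSup (p : K[X]) (c : K) : Continuous (rootSup p c) :=
  continuous_const.mul (continuous_multiset_prod _ fun _ _ => continuous_id.max continuous_const)

theorem rootSup_mul (p q : K[X]) (c : K) (t : ℝ) :
    rootSup (p * q) c t = rootSup p c t * rootSup q c t := by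
  by_cases hp : p = 0
  · simp [hp, rootSup]
  by_cases hq : q = 0
  · simp [hq, rootSup]
  simp only [rootSup, leadingCoeff_mul, roots_mul (mul_ne_zero hp hq), Multiset.map_add,
    Multiset.prod_add, norm_mul]
  ring

/-- Finitely many points of the closed unit disk miss some residue class: a root of
`∏ (X - aᵢ) - 1` has distance `1` from each `aᵢ`. -/
theorem exists_norm_sub_eq_one (s : Multiset K) (hs : ∀ a ∈ s, ‖a‖ ≤ 1) :
    ∃ x : K, ‖x‖ ≤ 1 ∧ ∀ a ∈ s, ‖x - a‖ = 1 := by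
  rcases Multiset.empty_or_exists_mem s with rfl | ⟨b, hb⟩
  · exact ⟨0, by simp, by simp⟩
  set P : K[X] := (s.map fun a => X - C a).prod with hP
  have hdeg : P.degree = s.card := by
    rw [hP, degree_multiset_prod_of_monic]
    · simp
    · simp only [Multiset.mem_map]
      rintro _ ⟨a, _, rfl⟩
      exact monic_X_sub_C a
  have hcard : 0 < s.card := Multiset.card_pos_iff_exists_mem.2 ⟨b, hb⟩
  obtain ⟨x, hx⟩ := IsAlgClosed.exists_root (P - C 1) (by
    rw [degree_sub_C (by rw [hdeg]; exact_mod_cast hcard), hdeg]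
    exact_mod_cast hcard.ne')
  have hprod : (s.map fun a => ‖x - a‖).prod = 1 := by
    have h1 : P.eval x = 1 := by simpa [IsRoot, sub_eq_zero] using hx
    have h2 : P.eval x = (s.map fun a => x - a).prod := by
      rw [hP, eval_multiset_prod, Multiset.map_map]; simp
    have h3 : (s.map fun a => ‖x - a‖).prod = ‖(s.map fun a => x - a).prod‖ := by
      clear hP hdeg hcard h1 h2 hs hb hx P
      induction s using Multiset.induction with
      | empty => simp
      | cons a s ih => simp [ih]
    rw [h3, ← h2, h1, norm_one]
  have hx1 : ‖x‖ ≤ 1 := by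
    by_contra! hlt
    have h4 : ∀ a ∈ s, ‖x - a‖ = ‖x‖ := fun a ha => by
      rw [sub_eq_add_neg, IsUltrametricDist.norm_add_eq_max_of_norm_ne_norm]
      · rw [norm_neg]; exact max_eq_left ((hs a ha).trans hlt.le)
      · rw [norm_neg]; exact ((hs a ha).trans_lt hlt).ne'
    rw [Multiset.map_congr rfl h4, Multiset.map_const', Multiset.prod_replicate] at hprod
    exact absurd hprod (one_lt_pow₀ hlt hcard.ne').ne'
  have hle : ∀ a ∈ s, ‖x - a‖ ≤ 1 := fun a ha =>
    (norm_sub_le_max' _ _).trans (max_le hx1 (hs a ha))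
  refine ⟨x, hx1, fun a ha => le_antisymm (hle a ha) ?_⟩
  obtain ⟨u, rfl⟩ := Multiset.exists_cons_of_mem ha
  rw [Multiset.map_cons, Multiset.prod_cons] at hprod
  have : (u.map fun a => ‖x - a‖).prod ≤ 1 := by
    have := Multiset.prod_map_le_prod_map₀ (s := u) (fun a => ‖x - a‖) (fun _ => 1) (fun _ _ => norm_nonneg _)
      (fun a ha => hle a (Multiset.mem_cons_of_mem ha))
    simpa using this
  calc 1 = _ := hprod.symm
    _ ≤ ‖x - a‖ * 1 := mul_le_mul_of_nonneg_left this (norm_nonneg _)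
    _ = _ := mul_one _

/-- The maximum of `|p|` on a disk whose radius is in the value group is attained. -/
theorem exists_norm_eval_eq_rootSup (p : K[X]) (c : K) {γ : K} (hγ : γ ≠ 0) :
    ∃ x : K, ‖x - c‖ ≤ ‖γ‖ ∧ ‖p.eval x‖ = rootSup p c ‖γ‖ := by
  classical
  have hγ' : 0 < ‖γ‖ := norm_pos_iff.2 hγ
  obtain ⟨y, hy1, hy⟩ := exists_norm_sub_eq_one
    ((p.roots.filter fun w => ‖c - w‖ ≤ ‖γ‖).map fun w => (w - c) / γ) (by
      intro a ha
      obtain ⟨w, hw, rfl⟩ := Multiset.mem_map.1 ha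
      rw [norm_div, div_le_one hγ', norm_sub_rev]
      exact (Multiset.mem_filter.1 hw).2)
  have hxc : ‖c + γ * y - c‖ ≤ ‖γ‖ := by
    rw [add_sub_cancel_left, norm_mul]
    exact mul_le_of_le_one_right hγ'.le hy1
  refine ⟨c + γ * y, hxc, ?_⟩
  rw [norm_eval_eq_prod, rootSup]
  congr 2
  refine Multiset.map_congr rfl fun w hw => ?_
  by_cases h : ‖c - w‖ ≤ ‖γ‖
  · have h1 := hy ((w - c) / γ) (Multiset.mem_map.2 ⟨w, Multiset.mem_filter.2 ⟨hw, h⟩, rfl⟩)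
    rw [max_eq_left h]
    have h2 : c + γ * y - w = γ * (y - (w - c) / γ) := by field_simp; ring
    rw [h2, norm_mul, h1, mul_one]
  · push Not at h
    rw [max_eq_right h.le]
    have h2 : c + γ * y - w = (c + γ * y - c) + (c - w) := by ring
    rw [h2, IsUltrametricDist.norm_add_eq_max_of_norm_ne_norm (hxc.trans_lt h).ne,
      max_eq_right (hxc.trans h.le)]

/-- The value group of an algebraically closed nontrivially normed field is dense. -/
theorem exists_norm_mem_Ioo (K : Type*) [NontriviallyNormedField K] [IsAlgClosed K] {a b : ℝ}
    (ha : 0 ≤ a) (hab : a < b) : ∃ γ : K, ‖γ‖ ∈ Set.Ioo a b := by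
  obtain ⟨x, hx⟩ := NormedField.exists_one_lt_norm K
  obtain ⟨a', ha', hab'⟩ := exists_between hab
  have ha0 : 0 < a' := ha.trans_lt ha'
  obtain ⟨n, hn⟩ := pow_unbounded_of_one_lt ‖x‖ ((one_lt_div ha0).2 hab')
  have hn0 : 0 < n := by
    rcases Nat.eq_zero_or_pos n with rfl | h
    · simp at hn; linarith
    · exact h
  obtain ⟨y, hy⟩ := IsAlgClosed.exists_pow_nat_eq x hn0
  have hyn : ‖y‖ ^ n = ‖x‖ := by rw [← norm_pow, hy]
  have hy1 : 1 < ‖y‖ := by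
    by_contra! h
    have := pow_le_one₀ (norm_nonneg y) h (n := n)
    linarith
  have hyb : ‖y‖ < b / a' := by
    have : 0 ≤ b / a' := div_nonneg (ha.trans hab.le) ha0.le
    exact lt_of_pow_lt_pow_left₀ n this (by rw [hyn]; exact hn)
  obtain ⟨m, hm1, hm2⟩ := exists_mem_Ioc_zpow ha0 hy1
  refine ⟨y ^ (m + 1), ?_, ?_⟩
  · rw [norm_zpow]; exact ha'.trans_le hm2
  · rw [norm_zpow, zpow_add_one₀ (by positivity)]
    calc ‖y‖ ^ m * ‖y‖ < a' * (b / a') := by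
          apply mul_lt_mul hm1 hyb.le (by positivity) ha0.le
      _ = b := by field_simp

/-- `rootSup p c t` is the least upper bound of `|p|` on `D⁺(c, t)`, also for `t` outside the
value group. -/
theorem rootSup_le_of_forall (p : K[X]) (c : K) {t M : ℝ} (ht : 0 < t)
    (h : ∀ x, ‖x - c‖ ≤ t → ‖p.eval x‖ ≤ M) : rootSup p c t ≤ M := by
  by_contra! hlt
  have h1 : ∀ᶠ s in 𝓝[<] t, M < rootSup p c s :=
    nhdsWithin_le_nhds ((continuous_rootSup p c).continuousAt.eventually (lt_mem_nhds hlt))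
  obtain ⟨a, ha, hsub⟩ := (mem_nhdsLT_iff_exists_Ioo_subset' ht).1 h1
  obtain ⟨γ, hγ1, hγ2⟩ := exists_norm_mem_Ioo K (le_max_right a 0) (max_lt ha ht)
  have hγ0 : 0 < ‖γ‖ := (le_max_right a 0).trans_lt hγ1
  obtain ⟨x, hx1, hx2⟩ := exists_norm_eval_eq_rootSup p c (norm_pos_iff.1 hγ0)
  have h2 : M < rootSup p c ‖γ‖ := hsub ⟨(le_max_left a 0).trans_lt hγ1, hγ2⟩
  linarith [h x (hx1.trans hγ2.le)]

theorem norm_coeff_multiset_prod_mul_pow_le (s : Multiset K) {t : ℝ} (ht : 0 ≤ t) (i : ℕ) :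
    ‖((s.map fun w => X - C w).prod).coeff i‖ * t ^ i ≤ (s.map fun w => max t ‖w‖).prod := by
  induction s using Multiset.induction generalizing i with
  | empty =>
    rcases i with _ | i
    · simp
    · simp [coeff_one]
  | cons w s ih =>
    have hpos : 0 ≤ (s.map fun w => max t ‖w‖).prod := Multiset.prod_nonneg fun _ h => by
      obtain ⟨w, _, rfl⟩ := Multiset.mem_map.1 h
      exact ht.trans (le_max_left _ _)
    rw [Multiset.map_cons, Multiset.prod_cons, Multiset.map_cons, Multiset.prod_cons]
    set Q := (s.map fun w => X - C w).prod
    rcases i with _ | i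
    · have := ih 0
      simp only [mul_coeff_zero, coeff_sub, coeff_X_zero, coeff_C_zero, zero_sub, norm_mul,
        norm_neg, pow_zero, mul_one] at this ⊢
      exact mul_le_mul (le_max_right _ _) this (norm_nonneg _) (ht.trans (le_max_left _ _))
    · have e : ((X - C w) * Q).coeff (i + 1) = Q.coeff i - w * Q.coeff (i + 1) := by
        rw [sub_mul, coeff_sub, coeff_X_mul, coeff_C_mul]
      rw [e]
      have h1 : ‖Q.coeff i‖ * t ^ (i + 1) ≤ max t ‖w‖ * (s.map fun w => max t ‖w‖).prod := by
        calc ‖Q.coeff i‖ * t ^ (i + 1) = t * (‖Q.coeff i‖ * t ^ i) := by ring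
          _ ≤ _ := mul_le_mul (le_max_left _ _) (ih i) (by positivity) (ht.trans (le_max_left _ _))
      have h2 : ‖w * Q.coeff (i + 1)‖ * t ^ (i + 1) ≤
          max t ‖w‖ * (s.map fun w => max t ‖w‖).prod := by
        rw [norm_mul, mul_assoc]
        exact mul_le_mul (le_max_right _ _) (ih (i + 1)) (by positivity)
          (ht.trans (le_max_left _ _))
      refine (mul_le_mul_of_nonneg_right (norm_sub_le_max' _ _) (by positivity)).trans ?_
      rw [max_mul_of_nonneg _ _ (by positivity)]
      exact max_le h1 h2

/-- Cauchy's estimate for a polynomial. -/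
theorem norm_coeff_mul_pow_le_rootSup (p : K[X]) {t : ℝ} (ht : 0 ≤ t) (i : ℕ) :
    ‖p.coeff i‖ * t ^ i ≤ rootSup p 0 t := by
  have h := (IsAlgClosed.splits p).eq_prod_roots
  have e : p.coeff i = p.leadingCoeff * ((p.roots.map fun w => X - C w).prod).coeff i := by
    conv_lhs => rw [h, coeff_C_mul]
  rw [e, norm_mul, mul_assoc, rootSup]
  simp only [zero_sub, norm_neg]
  exact mul_le_mul_of_nonneg_left (norm_coeff_multiset_prod_mul_pow_le _ ht i) (norm_nonneg _)

end PolynomialDisk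

/-! ### Taylor series and sup norms on closed disks -/

section BoundedAnalytic

variable {K : Type*} [NontriviallyNormedField K] [IsUltrametricDist K]

/-- A point of the open unit disk from a bound on its absolute value. -/
def Disk.mk (x : K) (hx : ‖x‖ < 1) : Disk K := ⟨x, mem_ball_zero_iff.2 hx⟩

@[simp] theorem Disk.coe_mk (x : K) (hx : ‖x‖ < 1) : ((Disk.mk x hx : Disk K) : K) = x := rfl

theorem Disk.norm_lt_one (z : Disk K) : ‖(z : K)‖ < 1 := mem_ball_zero_iff.1 z.2

theorem Disk.mem_closedBall {w c : Disk K} {r : ℝ} :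
    w ∈ Metric.closedBall c r ↔ ‖(w : K) - c‖ ≤ r := by
  rw [Metric.mem_closedBall, Subtype.dist_eq, dist_eq_norm]

instance : Nonempty (Disk K) := ⟨Disk.mk 0 (by simp)⟩

instance : Zero (Disk K) := ⟨Disk.mk 0 (by simp)⟩

@[simp] theorem Disk.coe_zero : ((0 : Disk K) : K) = 0 := rfl

theorem bddAbove_supNorm (f : HInf K) : BddAbove (Set.range fun z : Disk K => ‖f.1 z‖) := by
  obtain ⟨C, hC⟩ := f.2.2
  exact ⟨C, by rintro _ ⟨z, rfl⟩; exact hC z⟩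

theorem norm_le_supNorm (f : HInf K) (z : Disk K) : ‖f.1 z‖ ≤ supNorm f :=
  le_ciSup (bddAbove_supNorm f) z

theorem supNorm_le {f : HInf K} {C : ℝ} (h : ∀ z, ‖f.1 z‖ ≤ C) : supNorm f ≤ C := ciSup_le h

theorem supNorm_nonneg (f : HInf K) : 0 ≤ supNorm f :=
  (norm_nonneg _).trans (norm_le_supNorm f 0)

theorem supNorm_pos {f : HInf K} (hf : f ≠ 0) : 0 < supNorm f := by
  by_contra! h
  refine hf (Subtype.ext (funext fun z => ?_))
  exact norm_le_zero_iff.1 ((norm_le_supNorm f z).trans h)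

theorem norm_le_diskSup (f : HInf K) {c w : Disk K} {r : ℝ} (hw : ‖(w : K) - c‖ ≤ r) :
    ‖f.1 w‖ ≤ diskSup c r f := by
  refine le_ciSup (f := fun w : Metric.closedBall c r => ‖f.1 w.1‖) ?_
    ⟨w, Disk.mem_closedBall.2 hw⟩
  exact ⟨supNorm f, by rintro _ ⟨z, rfl⟩; exact norm_le_supNorm f z⟩

theorem diskSup_le {f : HInf K} {c : Disk K} {r C : ℝ} (hr : 0 ≤ r)
    (h : ∀ w : Disk K, ‖(w : K) - c‖ ≤ r → ‖f.1 w‖ ≤ C) : diskSup c r f ≤ C := by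
  have : Nonempty (Metric.closedBall c r) := ⟨⟨c, Metric.mem_closedBall_self hr⟩⟩
  exact ciSup_le fun w => h w.1 (Disk.mem_closedBall.1 w.2)

theorem diskSup_nonneg (f : HInf K) (c : Disk K) (r : ℝ) : 0 ≤ diskSup c r f :=
  Real.iSup_nonneg fun _ => norm_nonneg _

theorem diskSup_le_supNorm (f : HInf K) (c : Disk K) {r : ℝ} (hr : 0 ≤ r) :
    diskSup c r f ≤ supNorm f := diskSup_le hr fun w _ => norm_le_supNorm f w

theorem diskSup_mono (f : HInf K) {c c' : Disk K} {r r' : ℝ} (hr : 0 ≤ r) (hrr : r ≤ r')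
    (hc : ‖(c : K) - c'‖ ≤ r') : diskSup c r f ≤ diskSup c' r' f := by
  refine diskSup_le hr fun w hw => norm_le_diskSup f ?_
  have : (w : K) - c' = (w - c) + (c - c') := by ring
  rw [this]
  exact (IsUltrametricDist.norm_add_le_max _ _).trans (max_le (hw.trans hrr) hc)

theorem diskSup_add_le_max (f g : HInf K) (c : Disk K) {r : ℝ} (hr : 0 ≤ r) :
    diskSup c r (f + g) ≤ max (diskSup c r f) (diskSup c r g) :=
  diskSup_le hr fun _ hw => (IsUltrametricDist.norm_add_le_max _ _).trans
    (max_le_max (norm_le_diskSup f hw) (norm_le_diskSup g hw))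

theorem diskSup_neg (f : HInf K) (c : Disk K) (r : ℝ) : diskSup c r (-f) = diskSup c r f := by
  have : ∀ w : Disk K, ‖(-f).1 w‖ = ‖f.1 w‖ := fun w => norm_neg (f.1 w)
  simp only [diskSup, this]

theorem diskSup_mul_le (f g : HInf K) (c : Disk K) {r : ℝ} (hr : 0 ≤ r) :
    diskSup c r (f * g) ≤ diskSup c r f * diskSup c r g :=
  diskSup_le hr fun w hw => by
    have : (f * g).1 w = f.1 w * g.1 w := rfl
    rw [this, norm_mul]
    exact mul_le_mul (norm_le_diskSup f hw) (norm_le_diskSup g hw) (norm_nonneg _)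
      (diskSup_nonneg _ _ _)

theorem diskSup_eq_of_sub_lt {f g : HInf K} {c : Disk K} {r : ℝ} (hr : 0 ≤ r)
    (h : diskSup c r (f - g) < diskSup c r f) : diskSup c r g = diskSup c r f := by
  apply le_antisymm
  · have h1 := diskSup_add_le_max f (-(f - g)) c hr
    rw [diskSup_neg, max_eq_left h.le] at h1
    simpa using h1
  · have h1 := diskSup_add_le_max g (f - g) c hr
    rw [add_sub_cancel] at h1
    rcases le_max_iff.1 h1 with h2 | h2
    · exact h2
    · exact absurd h2 h.not_ge

/-- The power series `A` converges to `f` on the disk. -/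
def HasTaylor (f : HInf K) (A : PowerSeries K) : Prop :=
  ∀ z : Disk K, HasSum (fun n => PowerSeries.coeff n A * (z : K) ^ n) (f.1 z)

theorem exists_hasTaylor (f : HInf K) : ∃ A, HasTaylor f A := by
  obtain ⟨a, ha⟩ := f.2.1
  exact ⟨PowerSeries.mk a, fun z => by simpa using ha z⟩

theorem HasTaylor.add {f g : HInf K} {A B : PowerSeries K} (hf : HasTaylor f A)
    (hg : HasTaylor g B) : HasTaylor (f + g) (A + B) := fun z => by
  simpa [add_mul] using (hf z).add (hg z)

theorem HasTaylor.sub {f g : HInf K} {A B : PowerSeries K} (hf : HasTaylor f A)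
    (hg : HasTaylor g B) : HasTaylor (f - g) (A - B) := fun z => by
  simpa [sub_mul] using (hf z).sub (hg z)

theorem HasTaylor.mul {f g : HInf K} {A B : PowerSeries K} (hf : HasTaylor f A)
    (hg : HasTaylor g B) : HasTaylor (f * g) (A * B) := fun z => by
  have h3 := hasSum_cauchyProduct (hf z) (hg z)
  refine h3.congr_fun fun n => ?_
  rw [PowerSeries.coeff_mul, Finset.Nat.sum_antidiagonal_eq_sum_range_succ_mk, Finset.sum_mul]
  refine Finset.sum_congr rfl fun k hk => ?_
  have hkn : k + (n - k) = n := by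
    have := Finset.mem_range.1 hk
    omega
  have hz : (z : K) ^ n = (z : K) ^ k * (z : K) ^ (n - k) := by rw [← pow_add, hkn]
  rw [hz]
  ring

theorem hasTaylor_algebraMap (c : K) : HasTaylor (algebraMap K (HInf K) c) (PowerSeries.C c) :=
  fun z => by
    have h := hasSum_single (f := fun n : ℕ => PowerSeries.coeff n (PowerSeries.C c) * (z : K) ^ n) 0
      (fun n hn => by simp [PowerSeries.coeff_C, hn])
    simpa using h

theorem norm_le_of_hasSum {u : ℕ → K} {s : K} {C : ℝ} (hC : 0 ≤ C) (h : HasSum u s)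
    (hu : ∀ n, ‖u n‖ ≤ C) : ‖s‖ ≤ C := by
  rw [← h.tsum_eq]
  exact IsUltrametricDist.norm_tsum_le_of_forall_le_of_nonneg hC hu

variable [IsAlgClosed K]

/-- The Taylor polynomials converge uniformly on `|z| ≤ s`, `s < 1`. -/
theorem HasTaylor.eventually_norm_sub_le {f : HInf K} {A : PowerSeries K} (hf : HasTaylor f A)
    {s ε : ℝ} (hs : s < 1) (hε : 0 < ε) : ∀ᶠ m in atTop, ∀ z : Disk K, ‖(z : K)‖ ≤ s →
      ‖f.1 z - (A.trunc m).eval (z : K)‖ ≤ ε := by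
  obtain ⟨γ, hγ1, hγ2⟩ := exists_norm_mem_Ioo K (le_max_right s 0) (max_lt hs one_pos)
  have h0 := (hf (Disk.mk γ hγ2)).summable.tendsto_atTop_zero.norm
  rw [norm_zero] at h0
  obtain ⟨m₀, hm₀⟩ := eventually_atTop.1 (h0.eventually (ge_mem_nhds hε))
  filter_upwards [eventually_ge_atTop m₀] with m hm z hz
  have e : (A.trunc m).eval (z : K) =
      ∑ n ∈ Finset.range m, PowerSeries.coeff n A * (z : K) ^ n := by
    rw [← eval₂_id, PowerSeries.eval₂_trunc_eq_sum_range]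
    rfl
  have h1 := (hf z).sub (hasSum_sum_of_ne_finset_zero
    (f := fun n => if n ∈ Finset.range m then PowerSeries.coeff n A * (z : K) ^ n else 0)
    (s := Finset.range m) (fun n hn => if_neg hn))
  rw [Finset.sum_congr rfl (fun n hn => if_pos hn), ← e] at h1
  refine norm_le_of_hasSum hε.le h1 fun n => ?_
  by_cases hn : n ∈ Finset.range m
  · simp only [hn, if_true, sub_self, norm_zero]; exact hε.le
  · simp only [hn, if_false, sub_zero]
    have h2 := hm₀ n (hm.trans (by simpa using hn))
    refine le_trans ?_ h2
    rw [norm_mul, norm_mul, norm_pow, norm_pow]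
    have : ‖(z : K)‖ ≤ ‖γ‖ := hz.trans ((le_max_left _ _).trans hγ1.le)
    simp only [Disk.coe_mk]
    gcongr

/-- Cauchy's estimate. -/
theorem HasTaylor.norm_coeff_mul_pow_le {f : HInf K} {A : PowerSeries K} (hf : HasTaylor f A)
    {s C : ℝ} (hs0 : 0 < s) (hs : s < 1) (hC : ∀ z : Disk K, ‖(z : K)‖ ≤ s → ‖f.1 z‖ ≤ C)
    (i : ℕ) : ‖PowerSeries.coeff i A‖ * s ^ i ≤ C := by
  have hC0 : 0 ≤ C := (norm_nonneg _).trans (hC 0 (by simpa using hs0.le))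
  refine le_of_forall_pos_le_add fun ε hε => ?_
  obtain ⟨m, hm, hmi⟩ := ((hf.eventually_norm_sub_le hs hε).and (eventually_gt_atTop i)).exists
  have h1 : rootSup (A.trunc m) 0 s ≤ C + ε := by
    refine rootSup_le_of_forall _ _ hs0 fun x hx => ?_
    rw [sub_zero] at hx
    have h2 := hm (Disk.mk x (hx.trans_lt hs)) hx
    have h3 := hC (Disk.mk x (hx.trans_lt hs)) hx
    have h4 := norm_sub_le (f.1 (Disk.mk x (hx.trans_lt hs)))
      (f.1 (Disk.mk x (hx.trans_lt hs)) - (A.trunc m).eval x)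
    rw [sub_sub_cancel] at h4
    exact h4.trans (add_le_add h3 h2)
  have h5 := norm_coeff_mul_pow_le_rootSup (A.trunc m) hs0.le i
  rw [PowerSeries.coeff_trunc, if_pos hmi] at h5
  exact h5.trans h1

theorem HasTaylor.norm_coeff_le {f : HInf K} {A : PowerSeries K} (hf : HasTaylor f A) (i : ℕ) :
    ‖PowerSeries.coeff i A‖ ≤ supNorm f := by
  have h : Tendsto (fun s : ℝ => ‖PowerSeries.coeff i A‖ * s ^ i) (𝓝[<] 1)
      (𝓝 (‖PowerSeries.coeff i A‖ * 1 ^ i)) :=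
    ((continuous_const.mul (continuous_pow i)).tendsto 1).mono_left nhdsWithin_le_nhds
  rw [one_pow, mul_one] at h
  refine le_of_tendsto h ?_
  filter_upwards [Ioo_mem_nhdsLT (zero_lt_one (α := ℝ))] with s hs
  exact hf.norm_coeff_mul_pow_le hs.1 hs.2 (fun z _ => norm_le_supNorm f z) i

theorem HasTaylor.unique {f : HInf K} {A B : PowerSeries K} (hA : HasTaylor f A)
    (hB : HasTaylor f B) : A = B := by
  ext i
  have h := (hA.sub hB).norm_coeff_le i
  have h0 : supNorm (f - f) ≤ 0 := supNorm_le fun z => by simp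
  have := norm_le_zero_iff.1 (h.trans h0)
  rwa [map_sub, sub_eq_zero] at this

/-- The Taylor series at `0`, as a ring homomorphism. -/
def toPS (K : Type*) [NontriviallyNormedField K] [IsUltrametricDist K] [IsAlgClosed K] :
    HInf K →+* PowerSeries K where
  toFun f := (exists_hasTaylor f).choose
  map_one' := (exists_hasTaylor 1).choose_spec.unique (by simpa using hasTaylor_algebraMap (K := K) 1)
  map_zero' := (exists_hasTaylor 0).choose_spec.unique (by simpa using hasTaylor_algebraMap (K := K) 0)
  map_add' f g := (exists_hasTaylor _).choose_spec.unique
    ((exists_hasTaylor f).choose_spec.add (exists_hasTaylor g).choose_spec)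
  map_mul' f g := (exists_hasTaylor _).choose_spec.unique
    ((exists_hasTaylor f).choose_spec.mul (exists_hasTaylor g).choose_spec)

theorem hasTaylor_toPS (f : HInf K) : HasTaylor f (toPS K f) := (exists_hasTaylor f).choose_spec

theorem HasTaylor.toPS_eq {f : HInf K} {A : PowerSeries K} (h : HasTaylor f A) : toPS K f = A :=
  (hasTaylor_toPS f).unique h

theorem toPS_injective : Function.Injective (toPS K) := fun f g h => by
  refine Subtype.ext (funext fun z => ?_)
  have h1 := hasTaylor_toPS f z
  rw [h] at h1
  exact h1.unique (hasTaylor_toPS g z)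

@[simp] theorem toPS_algebraMap (c : K) : toPS K (algebraMap K (HInf K) c) = PowerSeries.C c :=
  (hasTaylor_algebraMap c).toPS_eq

theorem norm_le_of_coeff (f : HInf K) {z : Disk K} {s C : ℝ} (hz : ‖(z : K)‖ ≤ s)
    (h : ∀ i, ‖PowerSeries.coeff i (toPS K f)‖ * s ^ i ≤ C) : ‖f.1 z‖ ≤ C := by
  have hC : 0 ≤ C := by simpa using (mul_nonneg (norm_nonneg _) (by simp)).trans (h 0)
  refine norm_le_of_hasSum hC (hasTaylor_toPS f z) fun n => ?_
  rw [norm_mul, norm_pow]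
  exact (by gcongr : _ ≤ _).trans (h n)

theorem supNorm_le_of_coeff (f : HInf K) {C : ℝ}
    (h : ∀ i, ‖PowerSeries.coeff i (toPS K f)‖ ≤ C) : supNorm f ≤ C :=
  supNorm_le fun z => norm_le_of_coeff f z.norm_lt_one.le (by simpa using h)

theorem diskSup_zero_le_of_coeff (f : HInf K) {s C : ℝ} (hs : 0 ≤ s)
    (h : ∀ i, ‖PowerSeries.coeff i (toPS K f)‖ * s ^ i ≤ C) : diskSup 0 s f ≤ C :=
  diskSup_le hs fun z hz => norm_le_of_coeff f (by simpa using hz) h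

theorem norm_coeff_mul_pow_le_diskSup (f : HInf K) {s : ℝ} (hs : 0 < s) (hs1 : s < 1) (i : ℕ) :
    ‖PowerSeries.coeff i (toPS K f)‖ * s ^ i ≤ diskSup 0 s f :=
  (hasTaylor_toPS f).norm_coeff_mul_pow_le hs hs1
    (fun _ hz => norm_le_diskSup f (by simpa using hz)) i

theorem norm_coeff_le_supNorm (f : HInf K) (i : ℕ) :
    ‖PowerSeries.coeff i (toPS K f)‖ ≤ supNorm f := (hasTaylor_toPS f).norm_coeff_le i

theorem exists_toPS_eq [CompleteSpace K] (A : PowerSeries K) {C : ℝ}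
    (h : ∀ i, ‖PowerSeries.coeff i A‖ ≤ C) : ∃ f : HInf K, toPS K f = A := by
  have hC : 0 ≤ C := (norm_nonneg _).trans (h 0)
  have hsum : ∀ z : Disk K, Summable fun n => PowerSeries.coeff n A * (z : K) ^ n := fun z => by
    have := nonarchimedeanRing K
    apply NonarchimedeanAddGroup.summable_of_tendsto_cofinite_zero
    rw [Nat.cofinite_eq_atTop, tendsto_zero_iff_norm_tendsto_zero]
    refine squeeze_zero (fun _ => norm_nonneg _) (g := fun n => C * ‖(z : K)‖ ^ n) (fun n => ?_) ?_
    · rw [norm_mul, norm_pow]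
      exact mul_le_mul_of_nonneg_right (h n) (by positivity)
    · simpa using (tendsto_pow_atTop_nhds_zero_of_lt_one (norm_nonneg _)
        z.norm_lt_one).const_mul C
  let F : HInf K := ⟨fun z => ∑' n, PowerSeries.coeff n A * (z : K) ^ n,
    ⟨fun n => PowerSeries.coeff n A, fun z => (hsum z).hasSum⟩, C, fun z => by
      refine norm_le_of_hasSum hC (hsum z).hasSum fun n => ?_
      rw [norm_mul, norm_pow]
      calc _ ≤ C * 1 := mul_le_mul (h n) (pow_le_one₀ (norm_nonneg _) z.norm_lt_one.le)
            (by positivity) hC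
        _ = C := mul_one C⟩
  exact ⟨F, HasTaylor.toPS_eq fun z => (hsum z).hasSum⟩

/-- The coordinate function `z`. -/
def coord (K : Type*) [NontriviallyNormedField K] [IsUltrametricDist K] : HInf K :=
  ⟨fun z => z, ⟨fun n => if n = 1 then 1 else 0, fun z => by
    have h := hasSum_single (f := fun n : ℕ => (if n = 1 then 1 else 0) * (z : K) ^ n) 1
      (fun n hn => by simp [hn])
    simpa using h⟩, 1, fun z => z.norm_lt_one.le⟩

@[simp] theorem toPS_coord : toPS K (coord K) = PowerSeries.X :=
  HasTaylor.toPS_eq fun z => by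
    have h := hasSum_single
      (f := fun n : ℕ => PowerSeries.coeff n (PowerSeries.X : PowerSeries K) * (z : K) ^ n) 1
      (fun n hn => by simp [PowerSeries.coeff_X, hn])
    rwa [PowerSeries.coeff_one_X, pow_one, one_mul] at h

/-- A polynomial as a bounded analytic function. -/
def polyH (K : Type*) [NontriviallyNormedField K] [IsUltrametricDist K] : K[X] →ₐ[K] HInf K :=
  aeval (coord K)

theorem polyH_apply (p : K[X]) (z : Disk K) : (polyH K p).1 z = p.eval (z : K) := by
  induction p using Polynomial.induction_on' with
  | add p q hp hq => rw [map_add, eval_add, ← hp, ← hq]; rfl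
  | monomial n a =>
    rw [polyH, aeval_monomial, eval_monomial]
    have h : ∀ n : ℕ, (coord K ^ n).1 z = (z : K) ^ n := fun n => rfl
    change a * (coord K ^ n).1 z = _
    rw [h]

theorem toPS_polyH (p : K[X]) : toPS K (polyH K p) = (p : PowerSeries K) := by
  induction p using Polynomial.induction_on' with
  | add p q hp hq => rw [map_add, map_add, hp, hq, Polynomial.coe_add]
  | monomial n a =>
    rw [polyH, aeval_monomial, map_mul, map_pow, toPS_algebraMap, toPS_coord, coe_monomial,
      PowerSeries.X_pow_eq]
    ext i
    simp [PowerSeries.coeff_monomial]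

/-- Approximation of `f` by its Taylor polynomials on the disk `|z| ≤ s`. -/
theorem exists_polynomial_approx (f : HInf K) {s ε : ℝ} (hs : s < 1) (hε : 0 < ε) :
    ∃ p : K[X], (∀ z : Disk K, ‖(z : K)‖ ≤ s → ‖(f - polyH K p).1 z‖ ≤ ε) ∧
      ∀ i, ‖p.coeff i‖ ≤ supNorm f := by
  obtain ⟨m, hm⟩ := ((hasTaylor_toPS f).eventually_norm_sub_le hs hε).exists
  refine ⟨(toPS K f).trunc m, fun z hz => ?_, fun i => ?_⟩
  · have := hm z hz
    rwa [← polyH_apply] at this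
  · rw [PowerSeries.coeff_trunc]
    split_ifs
    · exact norm_coeff_le_supNorm f i
    · simpa using supNorm_nonneg f

theorem exists_diskSup_sub_polyH_le (f : HInf K) (c : Disk K) {r ε : ℝ} (hr : 0 ≤ r) (hr1 : r < 1)
    (hε : 0 < ε) : ∃ p : K[X], diskSup c r (f - polyH K p) ≤ ε := by
  obtain ⟨p, hp, _⟩ := exists_polynomial_approx f (max_lt hr1 c.norm_lt_one) hε
  refine ⟨p, diskSup_le hr fun w hw => hp w ?_⟩
  have : (w : K) = (w - c) + c := by ring
  rw [this]
  exact (IsUltrametricDist.norm_add_le_max _ _).trans (max_le_max_right _ hw)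

theorem diskSup_polyH (p : K[X]) (c : Disk K) {r : ℝ} (hr : 0 < r) (hr1 : r < 1) :
    diskSup c r (polyH K p) = rootSup p c r := by
  apply le_antisymm
  · refine diskSup_le hr.le fun w hw => ?_
    rw [polyH_apply]
    exact norm_eval_le_rootSup p hw
  · refine rootSup_le_of_forall p c hr fun x hx => ?_
    have hx1 : ‖x‖ < 1 := by
      have : x = (x - c) + c := by ring
      rw [this]
      exact (IsUltrametricDist.norm_add_le_max _ _).trans_lt (max_lt (hx.trans_lt hr1) c.norm_lt_one)
    have := norm_le_diskSup (polyH K p) (c := c) (w := Disk.mk x hx1) hx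
    rwa [polyH_apply] at this

/-- The sup norm on a closed disk is multiplicative. -/
theorem diskSup_mul (f g : HInf K) (c : Disk K) {r : ℝ} (hr : 0 < r) (hr1 : r < 1) :
    diskSup c r (f * g) = diskSup c r f * diskSup c r g := by
  have hle := diskSup_mul_le f g c hr.le
  rcases (diskSup_nonneg f c r).eq_or_lt' with hf | hf
  · rw [hf, zero_mul] at hle ⊢
    exact le_antisymm hle (diskSup_nonneg _ _ _)
  rcases (diskSup_nonneg g c r).eq_or_lt' with hg | hg
  · rw [hg, mul_zero] at hle ⊢
    exact le_antisymm hle (diskSup_nonneg _ _ _)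
  obtain ⟨p, hp⟩ := exists_diskSup_sub_polyH_le f c hr.le hr1 (half_pos hf)
  obtain ⟨q, hq⟩ := exists_diskSup_sub_polyH_le g c hr.le hr1 (half_pos hg)
  replace hp := hp.trans_lt (half_lt_self hf)
  replace hq := hq.trans_lt (half_lt_self hg)
  have hp' := diskSup_eq_of_sub_lt hr.le hp
  have hq' := diskSup_eq_of_sub_lt hr.le hq
  have hpq : diskSup c r (polyH K p * polyH K q) = diskSup c r f * diskSup c r g := by
    rw [← map_mul, diskSup_polyH _ _ hr hr1, rootSup_mul, ← diskSup_polyH _ _ hr hr1,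
      ← diskSup_polyH _ _ hr hr1, hp', hq']
  rw [← hpq]
  refine diskSup_eq_of_sub_lt hr.le ?_
  have e : polyH K p * polyH K q - f * g =
      -((f - polyH K p) * polyH K q + f * (g - polyH K q)) := by ring
  rw [e, diskSup_neg, hpq]
  refine (diskSup_add_le_max _ _ _ hr.le).trans_lt (max_lt ?_ ?_)
  · refine (diskSup_mul_le _ _ _ hr.le).trans_lt ?_
    rw [hq']
    exact mul_lt_mul_of_pos_right hp hg
  · exact (diskSup_mul_le _ _ _ hr.le).trans_lt (mul_lt_mul_of_pos_left hq hf)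

end BoundedAnalytic

/-! ### Radii at which a given value is attained, limits, and separated disks -/

section Levels

variable {K : Type*} [NontriviallyNormedField K] [IsUltrametricDist K] [IsAlgClosed K]

theorem abs_diskSup_sub_le (f g : HInf K) (c : Disk K) {r : ℝ} (hr : 0 ≤ r) :
    |diskSup c r f - diskSup c r g| ≤ diskSup c r (f - g) := by
  have key : ∀ f g : HInf K, diskSup c r f ≤ diskSup c r g + diskSup c r (f - g) := fun f g => by
    have h := diskSup_add_le_max g (f - g) c hr
    rw [add_sub_cancel] at h
    exact h.trans (max_le_add_of_nonneg (diskSup_nonneg _ _ _) (diskSup_nonneg _ _ _))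
  have h1 := key f g
  have h2 := key g f
  rw [← neg_sub f g, diskSup_neg] at h2
  rw [abs_le]
  constructor <;> linarith

theorem continuousOn_diskSup (f : HInf K) (c : Disk K) {a b : ℝ} (ha : 0 < a) (hb : b < 1) :
    ContinuousOn (fun t => diskSup c t f) (Set.Icc a b) := by
  refine continuousOn_of_uniform_approx_of_continuousOn fun u hu => ?_
  obtain ⟨ε, hε, hεu⟩ := Metric.mem_uniformity_dist.1 hu
  obtain ⟨p, hp⟩ := exists_diskSup_sub_polyH_le f c (le_max_right b 0) (max_lt hb one_pos)
    (half_pos hε)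
  refine ⟨rootSup p c, (continuous_rootSup p c).continuousOn, fun t ht => hεu ?_⟩
  have ht0 : 0 < t := ha.trans_le ht.1
  rw [Real.dist_eq, ← diskSup_polyH p c ht0 (ht.2.trans_lt hb)]
  refine (abs_diskSup_sub_le _ _ _ ht0.le).trans_lt (lt_of_le_of_lt ?_ (half_lt_self hε))
  exact (diskSup_mono _ ht0.le (ht.2.trans (le_max_left _ _)) (by simp)).trans hp

/-- Each value between `sup_{D⁺(c, r₀)} |f|` and `‖f‖` is attained as `sup_{D⁺(c, T)} |f|` for a
largest radius `T`. -/
theorem exists_maximal_radius (f : HInf K) (c : Disk K) {r₀ ρ : ℝ} (hr₀ : 0 < r₀) (hr₁ : r₀ < 1)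
    (hle : diskSup c r₀ f ≤ ρ) (hρ : ρ < supNorm f) :
    ∃ T, r₀ ≤ T ∧ T < 1 ∧ diskSup c T f = ρ ∧ ∀ t, T < t → t < 1 → ρ < diskSup c t f := by
  obtain ⟨x, hx⟩ := exists_lt_of_lt_ciSup hρ
  obtain ⟨s, hs⟩ : ∃ s, s = max r₀ (max ‖(x : K)‖ ‖(c : K)‖) := ⟨_, rfl⟩
  have hs1 : s < 1 := hs ▸ max_lt hr₁ (max_lt x.norm_lt_one c.norm_lt_one)
  have hrs : r₀ ≤ s := hs ▸ le_max_left _ _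
  have hρs : ρ < diskSup c s f := hx.trans_le (norm_le_diskSup f
    ((norm_sub_le_max' _ _).trans (hs ▸ le_max_right _ _)))
  have hcont := continuousOn_diskSup f c hr₀ hs1
  set A : Set ℝ := Set.Icc r₀ s ∩ {t | diskSup c t f ≤ ρ} with hA
  have hAc : IsCompact A := by
    have : IsClosed A := hcont.preimage_isClosed_of_isClosed isClosed_Icc isClosed_Iic
    exact isCompact_Icc.of_isClosed_subset this Set.inter_subset_left
  have hTA : sSup A ∈ A := hAc.sSup_mem ⟨r₀, ⟨le_rfl, hrs⟩, hle⟩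
  set T := sSup A
  have hlt : ∀ t, T < t → t ≤ s → ρ < diskSup c t f := fun t ht hts => by
    by_contra! h
    exact ht.not_ge (le_csSup hAc.bddAbove ⟨⟨hTA.1.1.trans ht.le, hts⟩, h⟩)
  refine ⟨T, hTA.1.1, hTA.1.2.trans_lt hs1, ?_, fun t ht ht1 => ?_⟩
  · obtain ⟨t, ht, hft⟩ := intermediate_value_Icc hTA.1.2
      (hcont.mono (Set.Icc_subset_Icc_left hTA.1.1)) ⟨hTA.2, hρs.le⟩
    rcases ht.1.eq_or_lt with h | h
    · rw [h]; exact hft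
    · exact absurd hft (hlt t h ht.2).ne'
  · rcases le_total t s with h | h
    · exact hlt t ht h
    · exact hρs.trans_le (diskSup_mono f (hr₀.le.trans hrs) h
        (by simpa using (hr₀.le.trans hrs).trans h))

theorem diskSup_one (c : Disk K) {r : ℝ} (hr : 0 ≤ r) : diskSup c r (1 : HInf K) = 1 := by
  have h : ∀ w : Disk K, ‖(1 : HInf K).1 w‖ = 1 := fun w => norm_one
  exact le_antisymm (diskSup_le hr fun w _ => (h w).le)
    ((h c).symm.le.trans (norm_le_diskSup 1 (by simpa using hr)))

/-- The limit of the `ζ_{D⁺(zₙ, rₙ)}` exists in the Berkovich space, the values at `f` lying in the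
compact interval `[0, ‖f‖]`. -/
theorem exists_berkovich_tendsto (F : Ultrafilter ℕ) (z : ℕ → Disk K) (r : ℕ → ℝ)
    (hr : ∀ n, r n ∈ Set.Ioo (0 : ℝ) 1) : ∃ ψ : Berkovich K, ∀ f : HInf K,
      Tendsto (fun n => diskSup (z n) (r n) f) (F : Filter ℕ) (𝓝 (ψ f)) := by
  have hex : ∀ f : HInf K, ∃ x ∈ Set.Icc 0 (supNorm f),
      Tendsto (fun n => diskSup (z n) (r n) f) (F : Filter ℕ) (𝓝 x) := fun f => by
    refine isCompact_Icc.ultrafilter_le_nhds (F.map fun n => diskSup (z n) (r n) f) ?_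
    rw [Ultrafilter.coe_map]
    exact tendsto_principal.2 (Eventually.of_forall fun n => ⟨diskSup_nonneg _ _ _, diskSup_le_supNorm _ _ (hr n).1.le⟩)
  choose L hL hlim using hex
  refine ⟨⟨⟨⟨L, ?_, ?_, ?_⟩, ?_, ?_⟩, fun f => (hL f).2⟩, hlim⟩
  · exact le_antisymm ((hL 0).2.trans (supNorm_le fun z => norm_zero.le)) (hL 0).1
  · intro f g
    refine le_of_tendsto_of_tendsto' (hlim _) ((hlim f).add (hlim g)) fun n => ?_
    exact (diskSup_add_le_max f g _ (hr n).1.le).trans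
      (max_le_add_of_nonneg (diskSup_nonneg _ _ _) (diskSup_nonneg _ _ _))
  · intro f
    refine tendsto_nhds_unique (hlim (-f)) ?_
    simpa only [diskSup_neg] using hlim f
  · refine tendsto_nhds_unique (hlim 1) ?_
    simp only [diskSup_one _ (hr _).1.le]
    exact tendsto_const_nhds
  · intro f g
    refine tendsto_nhds_unique (hlim (f * g)) ?_
    simp only [diskSup_mul _ _ _ (hr _).1 (hr _).2]
    exact (hlim f).mul (hlim g)

theorem exists_root_of_rootSup_lt (p : K[X]) (c : K) {t₁ t₂ : ℝ} (h : t₁ ≤ t₂)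
    (hlt : rootSup p c t₁ < rootSup p c t₂) : ∃ w ∈ p.roots, ‖c - w‖ ≤ t₂ := by
  by_contra! hw
  refine hlt.ne ?_
  rw [rootSup, rootSup]
  congr 2
  refine Multiset.map_congr rfl fun w hwr => ?_
  rw [max_eq_right (h.trans (hw w hwr).le), max_eq_right (hw w hwr).le]

theorem rootSup_zero_one_le (p : K[X]) {C : ℝ} (h : ∀ i, ‖p.coeff i‖ ≤ C) :
    rootSup p 0 1 ≤ C := by
  obtain ⟨x, hx, hpx⟩ := exists_norm_eval_eq_rootSup p 0 (one_ne_zero (α := K))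
  rw [norm_one] at hx hpx
  rw [sub_zero] at hx
  have hC : 0 ≤ C := (norm_nonneg _).trans (h 0)
  rw [← hpx, eval_eq_sum_range]
  refine IsUltrametricDist.norm_sum_le_of_forall_le_of_nonneg hC fun i _ => ?_
  rw [norm_mul, norm_pow]
  calc _ ≤ C * 1 := mul_le_mul (h i) (pow_le_one₀ (norm_nonneg _) hx) (by positivity) hC
    _ = C := mul_one C

theorem prod_map_max_nonneg (s : Multiset K) (c : K) {t : ℝ} (ht : 0 ≤ t) :
    0 ≤ (s.map fun w => max t ‖c - w‖).prod := Multiset.prod_nonneg fun _ h => by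
  obtain ⟨w, _, rfl⟩ := Multiset.mem_map.1 h
  exact ht.trans (le_max_left _ _)

/-- If `|f|` has the same supremum `ρ` on finitely many separated disks `D⁺(zᵢ, Tᵢ)`, `i ∈ S ∪ {n}`,
and a smaller one on each `D⁺(zᵢ, rᵢ)`, then every disk holds a root of a polynomial close to `f`;
splitting off the roots with `i ∈ S` from the root formula on `D⁺(zₙ, Tₙ)` bounds `ρ`. -/
theorem le_supNorm_mul_prod {ι : Type*} [DecidableEq ι] {f : HInf K} {z : ι → Disk K}
    {r T : ι → ℝ} {ρ : ℝ} (hρ : 0 < ρ) {n : ι} {S : Finset ι} (hn : n ∉ S)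
    (hr : ∀ i ∈ insert n S, 0 < r i ∧ r i ≤ T i ∧ T i < 1)
    (hlow : ∀ i ∈ insert n S, diskSup (z i) (r i) f < ρ)
    (hlev : ∀ i ∈ insert n S, diskSup (z i) (T i) f = ρ)
    (hsep : ∀ i ∈ insert n S, ∀ j ∈ insert n S, i ≠ j → T i < ‖(z i : K) - z j‖) :
    ρ ≤ supNorm f * ∏ m ∈ S, ‖(z n : K) - z m‖ := by
  have hs : ∀ᶠ s in 𝓝[<] (1 : ℝ), ∀ i ∈ insert n S, max (T i) ‖(z i : K)‖ ≤ s := by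
    rw [Filter.eventually_all_finset]
    intro i hi
    filter_upwards [Ioo_mem_nhdsLT (max_lt (hr i hi).2.2 (z i).norm_lt_one)] with s hs
    exact hs.1.le
  obtain ⟨s, hs, hs1⟩ := (hs.and self_mem_nhdsWithin).exists
  obtain ⟨p, hp, hpf⟩ := exists_polynomial_approx f hs1 (half_pos hρ)
  have happ : ∀ i ∈ insert n S, ∀ t, 0 ≤ t → t ≤ T i →
      diskSup (z i) t (f - polyH K p) ≤ ρ / 2 := fun i hi t ht0 ht => by
    refine diskSup_le ht0 fun w hw => hp w ?_
    have : (w : K) = (w - z i) + z i := by ring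
    rw [this]
    exact (IsUltrametricDist.norm_add_le_max _ _).trans
      ((max_le_max_right _ (hw.trans ht)).trans (hs i hi))
  have hT : ∀ i ∈ insert n S, rootSup p (z i) (T i) = ρ := fun i hi => by
    have h := hr i hi
    have hT0 : 0 < T i := h.1.trans_le h.2.1
    rw [← diskSup_polyH p (z i) hT0 h.2.2, ← hlev i hi]
    refine diskSup_eq_of_sub_lt hT0.le ?_
    rw [hlev i hi]
    exact (happ i hi _ hT0.le le_rfl).trans_lt (half_lt_self hρ)
  have hroot : ∀ i ∈ insert n S, ∃ w ∈ p.roots, ‖(z i : K) - w‖ ≤ T i := fun i hi => by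
    have h := hr i hi
    refine exists_root_of_rootSup_lt p (z i) h.2.1 ?_
    rw [hT i hi, ← diskSup_polyH p (z i) h.1 (h.2.1.trans_lt h.2.2)]
    have h1 := diskSup_add_le_max f (-(f - polyH K p)) (z i) h.1.le
    rw [diskSup_neg, neg_sub, add_sub_cancel] at h1
    exact h1.trans_lt (max_lt (hlow i hi)
      ((happ i hi _ h.1.le h.2.1).trans_lt (half_lt_self hρ)))
  choose! w hwr hw using hroot
  have hnS := Finset.mem_insert_self n S
  have hS : ∀ i ∈ S, i ∈ insert n S := fun i hi => Finset.mem_insert_of_mem hi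
  -- `w j` lies in `D⁺(zⱼ, Tⱼ)`, so it is as far from `zᵢ` as `zⱼ` is.
  have hdist : ∀ i ∈ insert n S, ∀ j ∈ insert n S, i ≠ j → ‖(z i : K) - w j‖ = ‖(z i : K) - z j‖ := by
    intro i hi j hj hij
    have h1 : ‖(z j : K) - w j‖ < ‖(z i : K) - z j‖ := by
      rw [norm_sub_rev (z i : K)]
      exact (hw j hj).trans_lt (hsep j hj i hi hij.symm)
    have h2 : (z i : K) - w j = (z i - z j) + (z j - w j) := by ring
    rw [h2, IsUltrametricDist.norm_add_eq_max_of_norm_ne_norm h1.ne', max_eq_left h1.le]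
  have hinj : Set.InjOn w (S : Set ι) := by
    intro i hi j hj hij
    by_contra hne
    have h1 := hdist i (hS i hi) j (hS j hj) hne
    have h2 := hsep i (hS i hi) j (hS j hj) hne
    rw [← hij] at h1
    linarith [hw i (hS i hi)]
  have hsub : S.val.map w ≤ p.roots := by
    rw [Multiset.le_iff_subset (Multiset.Nodup.map_on (fun i hi j hj => hinj hi hj) S.nodup)]
    intro x hx
    obtain ⟨i, hi, rfl⟩ := Multiset.mem_map.1 hx
    exact hwr i (hS i hi)
  obtain ⟨V, hV⟩ := Multiset.le_iff_exists_add.1 hsub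
  have hTn : 0 ≤ T n := (hr n hnS).1.le.trans (hr n hnS).2.1
  have e1 : ((S.val.map w).map fun x => max (T n) ‖(z n : K) - x‖).prod =
      ∏ m ∈ S, ‖(z n : K) - z m‖ := by
    rw [Multiset.map_map, Finset.prod_eq_multiset_prod]
    congr 1
    refine Multiset.map_congr rfl fun m hm => ?_
    have hne : n ≠ m := fun h => hn (h ▸ hm)
    have h1 := hsep n hnS m (hS m hm) hne
    simp only [Function.comp_apply]
    rw [hdist n hnS m (hS m hm) hne, max_eq_right h1.le]
  have e2 : (V.map fun x => max (T n) ‖(z n : K) - x‖).prod ≤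
      (V.map fun x => max 1 ‖(0 : K) - x‖).prod := by
    refine Multiset.prod_map_le_prod_map₀ _ _ (fun _ _ => hTn.trans (le_max_left _ _))
      fun x _ => max_le ((hr n hnS).2.2.le.trans (le_max_left _ _)) ?_
    rw [zero_sub, norm_neg]
    exact (norm_sub_le_max' _ _).trans (max_le_max_right _ (z n).norm_lt_one.le)
  have e3 : 1 ≤ ((S.val.map w).map fun x => max 1 ‖(0 : K) - x‖).prod :=
    Multiset.one_le_prod_map fun _ _ => le_max_left _ _
  have e4 := rootSup_zero_one_le p hpf
  have e5 := hT n hnS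
  rw [rootSup, hV, Multiset.map_add, Multiset.prod_add] at e4 e5
  rw [e1] at e5
  set Q := ∏ m ∈ S, ‖(z n : K) - z m‖
  have hQ : 0 ≤ Q := Finset.prod_nonneg fun _ _ => norm_nonneg _
  have hV0 := prod_map_max_nonneg V 0 zero_le_one
  calc ρ = ‖p.leadingCoeff‖ * (Q * (V.map fun x => max (T n) ‖(z n : K) - x‖).prod) := e5.symm
    _ ≤ ‖p.leadingCoeff‖ * (Q * (V.map fun x => max 1 ‖(0 : K) - x‖).prod) := by gcongr
    _ = ‖p.leadingCoeff‖ * (1 * (V.map fun x => max 1 ‖(0 : K) - x‖).prod) * Q := by ring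
    _ ≤ _ := mul_le_mul_of_nonneg_right ((by gcongr : _ ≤ _).trans e4) hQ

theorem le_tprod_of_forall_le_prod {ι : Type*} {u : ι → ℝ} {δ : ℝ} (h0 : ∀ i, 0 ≤ u i)
    (h1 : ∀ i, u i ≤ 1) (h : ∀ S : Finset ι, δ ≤ ∏ i ∈ S, u i) : δ ≤ ∏' i, u i := by
  have hanti : Antitone fun S : Finset ι => ∏ i ∈ S, u i := fun S S' hSS => by
    classical
    simp only
    rw [← Finset.prod_sdiff hSS]
    exact mul_le_of_le_one_left (Finset.prod_nonneg fun i _ => h0 i)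
      (Finset.prod_le_one (fun i _ => h0 i) fun i _ => h1 i)
  have hp : HasProd u (⨅ S : Finset ι, ∏ i ∈ S, u i) := by
    rw [HasProd, SummationFilter.unconditional_filter]
    exact tendsto_atTop_ciInf hanti ⟨δ, by rintro _ ⟨S, rfl⟩; exact h S⟩
  rw [hp.tprod_eq]
  exact le_ciInf h

end Levels

/-! ### Points of `M₁` above a given point of `M₀` -/

section LevelLimit

variable {K : Type*} [NontriviallyNormedField K] [IsUltrametricDist K] [IsAlgClosed K]

theorem norm_sub_le_max_sub (a b c : K) : ‖a - c‖ ≤ max ‖a - b‖ ‖b - c‖ := by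
  simpa using IsUltrametricDist.norm_add_le_max (a - b) (b - c)

theorem Nonprincipal.le_atTop {F : Ultrafilter ℕ} (hF : Nonprincipal F) :
    (F : Filter ℕ) ≤ atTop := by
  rw [← Nat.cofinite_eq_atTop]
  exact F.le_cofinite_or_eq_pure.resolve_right fun ⟨n, hn⟩ => hF n hn

/-- Enlarging each disk `D⁺(zₙ, rₙ)` to the largest one on which `|f|` has supremum `ρ` turns a
limit `φ` that kills `f` into a point of `M₁` above `φ` with value `ρ` at `f`. The enlarged disks
are equal or disjoint, and the ultrafilter is transported to one index for each of them. -/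
theorem exists_mem_M₁_of_isDiskLimit {φ : Berkovich K} {F : Ultrafilter ℕ} {z : ℕ → Disk K}
    {r : ℕ → ℝ} (h : IsDiskLimit φ F z r) {f : HInf K} (hφf : φ f = 0) {ρ : ℝ} (hρ : 0 < ρ)
    (hρf : ρ < supNorm f) : ∃ ψ ∈ M₁ K, (∀ g : HInf K, φ g ≤ ψ g) ∧ ψ f = ρ := by
  classical
  obtain ⟨hnp, hz, hr, hlim⟩ := h
  have hzF := hz.mono_left hnp.le_atTop
  obtain ⟨x, hx⟩ := exists_lt_of_lt_ciSup hρf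
  obtain ⟨s, hs⟩ : ∃ s, s = ‖(x : K)‖ := ⟨_, rfl⟩
  have hs0 : 0 ≤ s := hs ▸ norm_nonneg _
  have hs1 : s < 1 := hs ▸ x.norm_lt_one
  have hρs : ρ < diskSup 0 s f := hx.trans_le (norm_le_diskSup f (by simp [hs]))
  set A : Set ℕ := {n | diskSup (z n) (r n) f < ρ ∧ s < ‖(z n : K)‖} with hA
  have hAF : A ∈ (F : Filter ℕ) := by
    have h1 := hlim f
    rw [hφf] at h1
    exact (h1.eventually (gt_mem_nhds hρ)).and (hzF.eventually (lt_mem_nhds hs1))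
  have hT : ∀ n ∈ A, ∃ T, r n ≤ T ∧ T < 1 ∧ diskSup (z n) T f = ρ ∧
      ∀ t, T < t → t < 1 → ρ < diskSup (z n) t f := fun n hn =>
    exists_maximal_radius f (z n) (hr n).1 (hr n).2 hn.1.le hρf
  choose! T hrT hT1 hTρ hTmax using hT
  set t : ℕ → ℝ := fun n => if n ∈ A then T n else r n with ht
  have htA : ∀ n ∈ A, t n = T n := fun n hn => if_pos hn
  have htIoo : ∀ n, t n ∈ Set.Ioo (0 : ℝ) 1 := fun n => by
    by_cases hn : n ∈ A
    · rw [htA n hn]; exact ⟨(hr n).1.trans_le (hrT n hn), hT1 n hn⟩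
    · rw [ht]; simp only [hn, if_false]; exact hr n
  have hrt : ∀ n ∈ A, r n ≤ t n := fun n hn => htA n hn ▸ hrT n hn
  have hlev : ∀ n ∈ A, diskSup (z n) (t n) f = ρ := fun n hn => htA n hn ▸ hTρ n hn
  have hmax : ∀ n ∈ A, ∀ u, t n < u → u < 1 → ρ < diskSup (z n) u f :=
    fun n hn => htA n hn ▸ hTmax n hn
  have heq : ∀ i ∈ A, ∀ j ∈ A, ‖(z i : K) - z j‖ ≤ max (t i) (t j) → t i = t j := by
    have key : ∀ i ∈ A, ∀ j ∈ A, ‖(z i : K) - z j‖ ≤ max (t i) (t j) → t j ≤ t i := by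
      intro i hi j hj hij
      by_contra! hlt
      rw [max_eq_right hlt.le] at hij
      have h1 := hmax i hi (t j) hlt (htIoo j).2
      have h2 := diskSup_mono f (c := z i) (c' := z j) (htIoo j).1.le le_rfl hij
      rw [hlev j hj] at h2
      linarith
    intro i hi j hj hij
    exact le_antisymm (key j hj i hi (by rwa [norm_sub_rev, max_comm])) (key i hi j hj hij)
  -- `e n` is the least index whose disk is that of `n`.
  set e : ℕ → ℕ := fun n => sInf {m | m ∈ A ∧ ‖(z m : K) - z n‖ ≤ t n} with he
  have he_spec : ∀ n ∈ A, e n ∈ A ∧ ‖(z (e n) : K) - z n‖ ≤ t n := fun n hn =>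
    Nat.sInf_mem (s := {m | m ∈ A ∧ ‖(z m : K) - z n‖ ≤ t n})
      ⟨n, hn, by simpa using (htIoo n).1.le⟩
  have he_t : ∀ n ∈ A, t (e n) = t n := fun n hn =>
    heq _ (he_spec n hn).1 n hn ((he_spec n hn).2.trans (le_max_right _ _))
  have he_disk : ∀ n ∈ A, ∀ g, diskSup (z (e n)) (t (e n)) g = diskSup (z n) (t n) g := by
    intro n hn g
    rw [he_t n hn]
    exact le_antisymm (diskSup_mono g (htIoo n).1.le le_rfl (he_spec n hn).2)
      (diskSup_mono g (htIoo n).1.le le_rfl (by rw [norm_sub_rev]; exact (he_spec n hn).2))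
  have he_eq : ∀ i ∈ A, ∀ j ∈ A, ‖(z i : K) - z j‖ ≤ max (t i) (t j) → e i = e j := by
    intro i hi j hj hij
    have htij := heq i hi j hj hij
    rw [htij, max_self] at hij
    simp only [he]
    congr 1
    ext m
    simp only [Set.mem_ofPred_eq, htij]
    refine and_congr_right fun _ => ⟨fun hm => ?_, fun hm => ?_⟩
    · exact (norm_sub_le_max_sub _ (z i : K) _).trans (max_le hm hij)
    · exact (norm_sub_le_max_sub _ (z j : K) _).trans (max_le hm (by rwa [norm_sub_rev]))
  have hsep : ∀ i ∈ e '' A, ∀ j ∈ e '' A, i ≠ j → t i < ‖(z i : K) - z j‖ := by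
    rintro _ ⟨n, hn, rfl⟩ _ ⟨m, hm, rfl⟩ hne
    by_contra! hle
    refine hne (he_eq n hn m hm ?_)
    rw [he_t n hn] at hle
    have h1 := (he_spec n hn).2
    rw [norm_sub_rev] at h1
    have h2 := (norm_sub_le_max_sub (z n : K) (z (e n)) (z (e m))).trans (max_le h1 hle)
    exact (norm_sub_le_max_sub (z n : K) (z (e m)) (z m)).trans
      (max_le_max h2 (he_spec m hm).2)
  have heA : ∀ i ∈ e '' A, i ∈ A := by
    rintro _ ⟨n, hn, rfl⟩
    exact (he_spec n hn).1
  have hCF : e '' A ∈ (F.map e : Ultrafilter ℕ) := by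
    rw [Ultrafilter.mem_map]
    exact mem_of_superset hAF fun n hn => ⟨n, hn, rfl⟩
  obtain ⟨ψ, hψ⟩ := exists_berkovich_tendsto F z t htIoo
  have hnp' : Nonprincipal (F.map e) := fun k hk => by
    have h1 : {k} ∈ F.map e := by rw [hk]; exact mem_pure.2 rfl
    rw [Ultrafilter.mem_map] at h1
    -- `|zₙ| = |z (e n)|` because the disk of `n` does not contain `0`.
    have h2 : ∀ n ∈ A, ‖(z (e n) : K)‖ = ‖(z n : K)‖ := fun n hn => by
      have h3 : t n < ‖(z n : K)‖ := by
        by_contra! hle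
        have h4 := diskSup_mono f (c := 0) (c' := z n) hs0 (hn.2.le.trans hle) (by simpa using hle)
        rw [hlev n hn] at h4
        linarith
      have h5 := (he_spec n hn).2.trans_lt h3
      have h6 : (z (e n) : K) = (z (e n) - z n) + z n := by ring
      rw [h6, IsUltrametricDist.norm_add_eq_max_of_norm_ne_norm h5.ne, max_eq_right h5.le]
    have h3 := hzF.eventually (lt_mem_nhds (z k).norm_lt_one)
    have h1' : ∀ᶠ n in (F : Filter ℕ), e n = k := h1
    have hA' : ∀ᶠ n in (F : Filter ℕ), n ∈ A := hAF
    obtain ⟨n, ⟨hn1, hn2⟩, hn3⟩ := ((h1'.and hA').and h3).exists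
    rw [← h2 n hn2, hn1] at hn3
    exact lt_irrefl _ hn3
  refine ⟨ψ, ⟨F.map e, z, t, ⟨hnp', hz, htIoo, fun g => ?_⟩, ⟨e '' A, hCF, ?_⟩, e '' A, hCF, ?_⟩,
    fun g => ?_, ?_⟩
  · rw [Ultrafilter.coe_map, tendsto_map'_iff]
    refine (hψ g).congr' ?_
    filter_upwards [hAF] with n hn
    exact (he_disk n hn g).symm
  · have hf0 : 0 < supNorm f := hρ.trans hρf
    have : Nonempty (e '' A) := (Filter.nonempty_of_mem hCF).to_subtype
    refine (div_pos hρ hf0).trans_le (le_ciInf fun n => le_tprod_of_forall_le_prod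
      (fun _ => norm_nonneg _) (fun m => ?_) fun S => ?_)
    · exact (norm_sub_le_max' _ _).trans (max_le (z n).norm_lt_one.le (z m).norm_lt_one.le)
    · have hmem : ∀ i ∈ insert n.1 (S.map (Function.Embedding.subtype _)), i ∈ e '' A := by
        intro i hi
        rcases Finset.mem_insert.1 hi with rfl | hi
        · exact n.2
        · obtain ⟨m, _, rfl⟩ := Finset.mem_map.1 hi
          exact m.2.1
      have h1 := le_supNorm_mul_prod (f := f) (z := z) (r := r) (T := t) hρ (n := n.1)
        (S := S.map (Function.Embedding.subtype _))
        (fun hn => by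
          obtain ⟨m, _, hm⟩ := Finset.mem_map.1 hn
          exact m.2.2 hm)
        (fun i hi => ⟨(hr i).1, hrt i (heA i (hmem i hi)), (htIoo i).2⟩)
        (fun i hi => (heA i (hmem i hi)).1) (fun i hi => hlev i (heA i (hmem i hi)))
        (fun i hi j hj => hsep i (hmem i hi) j (hmem j hj))
      rw [Finset.prod_map] at h1
      rw [div_le_iff₀' hf0]
      exact h1
  · intro i hi j hj hij
    refine Set.disjoint_left.2 fun w hwi hwj => ?_
    rw [Disk.mem_closedBall] at hwi hwj
    have h1 := hsep i hi j hj hij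
    have h2 := hsep j hj i hi hij.symm
    rw [norm_sub_rev] at h2 hwi
    have h3 := norm_sub_le_max_sub (z i : K) w (z j)
    rcases le_max_iff.1 h3 with h | h <;> linarith
  · refine le_of_tendsto_of_tendsto (hlim g) (hψ g) ?_
    filter_upwards [hAF] with n hn
    exact diskSup_mono g (hr n).1.le (hrt n hn) (by simpa using (htIoo n).1.le)
  · refine tendsto_nhds_unique (hψ f) (tendsto_const_nhds.congr' ?_)
    filter_upwards [hAF] with n hn
    exact (hlev n hn).symm

end LevelLimit

/-! ### Approximate division and local factors -/

section Division

variable {K : Type*} [NontriviallyNormedField K] [IsUltrametricDist K]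

instance : MulRingSeminormClass (Berkovich K) (HInf K) ℝ where
  map_add_le_add φ := map_add_le_add φ.toMulRingSeminorm
  map_neg_eq_map φ := map_neg_eq_map φ.toMulRingSeminorm
  map_mul φ := map_mul φ.toMulRingSeminorm
  map_one φ := map_one φ.toMulRingSeminorm
  map_zero φ := map_zero φ.toMulRingSeminorm

theorem Berkovich.le_supNorm (φ : Berkovich K) (f : HInf K) : φ f ≤ supNorm f := φ.le_supNorm' f

theorem Berkovich.mem_ker {φ : Berkovich K} {f : HInf K} : f ∈ φ.ker ↔ φ f = 0 := Iff.rfl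

theorem supNorm_mul_le (f g : HInf K) : supNorm (f * g) ≤ supNorm f * supNorm g :=
  supNorm_le fun z => by
    have : (f * g).1 z = f.1 z * g.1 z := rfl
    rw [this, norm_mul]
    exact mul_le_mul (norm_le_supNorm f z) (norm_le_supNorm g z) (norm_nonneg _)
      (supNorm_nonneg _)

theorem supNorm_add_le_max (f g : HInf K) : supNorm (f + g) ≤ max (supNorm f) (supNorm g) :=
  supNorm_le fun z => (IsUltrametricDist.norm_add_le_max _ _).trans
    (max_le_max (norm_le_supNorm f z) (norm_le_supNorm g z))

theorem supNorm_algebraMap_le (c : K) : supNorm (algebraMap K (HInf K) c) ≤ ‖c‖ :=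
  supNorm_le fun _ => le_rfl

theorem supNorm_one_le : supNorm (1 : HInf K) ≤ 1 := supNorm_le fun _ => norm_one.le

theorem supNorm_coord_sub_le {w : K} (hw : ‖w‖ ≤ 1) :
    supNorm (coord K - algebraMap K (HInf K) w) ≤ 1 :=
  supNorm_le fun z => (norm_sub_le_max' (z : K) w).trans (max_le z.norm_lt_one.le hw)

variable [IsAlgClosed K] [CompleteSpace K]

/-- Division of a bounded analytic function by `z - w`. -/
theorem exists_eq_coord_sub_mul_add (h : HInf K) {w : K} {s : ℝ} (hs : 0 < s) (hs1 : s < 1)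
    (hw : ‖w‖ ≤ s) : ∃ (q : HInf K) (c : K),
      h = (coord K - algebraMap K (HInf K) w) * q + algebraMap K (HInf K) c ∧
      ‖c‖ ≤ diskSup 0 s h ∧ diskSup 0 s q ≤ diskSup 0 s h / s ∧ supNorm q ≤ supNorm h := by
  set a : ℕ → K := fun i => PowerSeries.coeff i (toPS K h) with ha
  have ha1 : ∀ i, ‖a i‖ ≤ supNorm h := norm_coeff_le_supNorm h
  have has : ∀ i, ‖a i‖ * s ^ i ≤ diskSup 0 s h := norm_coeff_mul_pow_le_diskSup h hs hs1
  have hw1 : ‖w‖ < 1 := hw.trans_lt hs1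
  have hsum : ∀ k, Summable fun i => a (k + i) * w ^ i := fun k => by
    have := nonarchimedeanRing K
    apply NonarchimedeanAddGroup.summable_of_tendsto_cofinite_zero
    rw [Nat.cofinite_eq_atTop, tendsto_zero_iff_norm_tendsto_zero]
    refine squeeze_zero (fun _ => norm_nonneg _) (g := fun n => supNorm h * ‖w‖ ^ n)
      (fun n => ?_) ?_
    · rw [norm_mul, norm_pow]
      exact mul_le_mul_of_nonneg_right (ha1 _) (by positivity)
    · simpa using (tendsto_pow_atTop_nhds_zero_of_lt_one (norm_nonneg _) hw1).const_mul (supNorm h)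
  set R : ℕ → K := fun k => ∑' i, a (k + i) * w ^ i with hR
  have hrec : ∀ k, R k = a k + w * R (k + 1) := fun k => by
    simp only [hR]
    rw [(hsum k).tsum_eq_zero_add, ← tsum_mul_left]
    simp only [add_zero, pow_zero, mul_one]
    congr 1
    refine tsum_congr fun i => ?_
    rw [show k + (i + 1) = k + 1 + i by ring]
    ring
  have hR1 : ∀ k, ‖R k‖ ≤ supNorm h := fun k =>
    IsUltrametricDist.norm_tsum_le_of_forall_le_of_nonneg (supNorm_nonneg h) fun i => by
      rw [norm_mul, norm_pow]
      calc _ ≤ supNorm h * 1 := mul_le_mul (ha1 _) (pow_le_one₀ (norm_nonneg _) hw1.le)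
            (by positivity) (supNorm_nonneg h)
        _ = _ := mul_one _
  have hRs : ∀ k, ‖R k‖ * s ^ k ≤ diskSup 0 s h := fun k => by
    rw [← le_div_iff₀ (by positivity)]
    refine IsUltrametricDist.norm_tsum_le_of_forall_le_of_nonneg
      (div_nonneg (diskSup_nonneg _ _ _) (by positivity)) fun i => ?_
    rw [le_div_iff₀ (by positivity), norm_mul, norm_pow]
    calc ‖a (k + i)‖ * ‖w‖ ^ i * s ^ k ≤ ‖a (k + i)‖ * s ^ i * s ^ k := by gcongr
      _ = ‖a (k + i)‖ * s ^ (k + i) := by ring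
      _ ≤ _ := has _
  obtain ⟨q, hq⟩ := exists_toPS_eq (PowerSeries.mk fun k => R (k + 1)) (C := supNorm h)
    (fun i => by rw [PowerSeries.coeff_mk]; exact hR1 _)
  refine ⟨q, R 0, toPS_injective ?_, by simpa using hRs 0, ?_, ?_⟩
  · rw [map_add, map_mul, map_sub, toPS_coord, toPS_algebraMap, toPS_algebraMap, hq]
    ext k
    change a k = _
    rcases k with _ | k
    · simp [sub_mul, hrec 0]
    · simp [sub_mul, PowerSeries.coeff_succ_X_mul, hrec (k + 1)]
  · refine diskSup_zero_le_of_coeff q hs.le fun i => ?_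
    rw [hq, PowerSeries.coeff_mk, le_div_iff₀ hs]
    calc ‖R (i + 1)‖ * s ^ i * s = ‖R (i + 1)‖ * s ^ (i + 1) := by ring
      _ ≤ _ := hRs _
  · exact supNorm_le_of_coeff q fun i => by rw [hq, PowerSeries.coeff_mk]; exact hR1 _

theorem polyH_X_sub_C (w : K) : polyH K (X - C w) = coord K - algebraMap K (HInf K) w := by
  simp [polyH]

/-- Division of a bounded analytic function by a monic polynomial with all roots in `|w| ≤ s`. -/
theorem exists_eq_polyH_mul_add (W : Multiset K) {s : ℝ} (hs : 0 < s) (hs1 : s < 1)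
    (hW : ∀ w ∈ W, ‖w‖ ≤ s) (h : HInf K) : ∃ q R : HInf K,
      h = polyH K (W.map fun w => X - C w).prod * q + R ∧
      supNorm R * s ^ W.card ≤ diskSup 0 s h ∧ diskSup 0 s q * s ^ W.card ≤ diskSup 0 s h ∧
      supNorm q ≤ supNorm h := by
  induction W using Multiset.induction generalizing h with
  | empty =>
    refine ⟨h, 0, by simp, ?_, by simp, le_rfl⟩
    have : supNorm (0 : HInf K) ≤ 0 := supNorm_le fun _ => norm_zero.le
    simpa using this.trans (diskSup_nonneg h 0 s)
  | cons w W ih =>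
    have hws := hW w (Multiset.mem_cons_self w W)
    obtain ⟨q₁, c, h1, hc, hq₁, hq₁'⟩ := exists_eq_coord_sub_mul_add h hs hs1 hws
    obtain ⟨q, R, h2, hR, hq, hq'⟩ := ih (fun v hv => hW v (Multiset.mem_cons_of_mem hv)) q₁
    rw [le_div_iff₀ hs] at hq₁
    refine ⟨q, (coord K - algebraMap K (HInf K) w) * R + algebraMap K (HInf K) c, ?_, ?_, ?_,
      hq'.trans hq₁'⟩
    · rw [Multiset.map_cons, Multiset.prod_cons, map_mul, polyH_X_sub_C]
      conv_lhs => rw [h1, h2]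
      ring
    · rw [Multiset.card_cons]
      have h3 : supNorm ((coord K - algebraMap K (HInf K) w) * R) ≤ supNorm R :=
        (supNorm_mul_le _ _).trans (mul_le_of_le_one_left (supNorm_nonneg R)
          (supNorm_coord_sub_le (hws.trans hs1.le)))
      refine (mul_le_mul_of_nonneg_right ((supNorm_add_le_max _ _).trans
        (max_le_max h3 (supNorm_algebraMap_le c))) (by positivity)).trans ?_
      rw [max_mul_of_nonneg _ _ (by positivity)]
      refine max_le ?_ ?_
      · calc supNorm R * s ^ (W.card + 1) = supNorm R * s ^ W.card * s := by ring
          _ ≤ diskSup 0 s q₁ * s := by gcongr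
          _ ≤ _ := hq₁
      · exact (mul_le_of_le_one_right (norm_nonneg _) (pow_le_one₀ hs.le hs1.le)).trans hc
    · rw [Multiset.card_cons]
      calc diskSup 0 s q * s ^ (W.card + 1) = diskSup 0 s q * s ^ W.card * s := by ring
        _ ≤ diskSup 0 s q₁ * s := by gcongr
        _ ≤ _ := hq₁

theorem norm_coeff_inv_mul_pow_le {A : PowerSeries K} (h1 : PowerSeries.constantCoeff A = 1)
    {s : ℝ} (hs : 0 ≤ s) (hA : ∀ i, ‖PowerSeries.coeff i A‖ * s ^ i ≤ 1) (n : ℕ) :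
    ‖PowerSeries.coeff n A⁻¹‖ * s ^ n ≤ 1 := by
  induction n using Nat.strong_induction_on with
  | _ n ih =>
    rw [PowerSeries.coeff_inv, h1]
    split_ifs with hn
    · simp [hn]
    · rw [inv_one, neg_one_mul, norm_neg]
      rcases hs.eq_or_lt with rfl | hs
      · simp [hn]
      rw [← le_div_iff₀ (by positivity)]
      refine IsUltrametricDist.norm_sum_le_of_forall_le_of_nonneg (by positivity) fun x hx => ?_
      rw [le_div_iff₀ (by positivity)]
      split_ifs with hx2
      · rw [norm_mul, ← Finset.HasAntidiagonal.mem_antidiagonal.1 hx, pow_add]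
        calc _ = (‖PowerSeries.coeff x.1 A‖ * s ^ x.1) * (‖PowerSeries.coeff x.2 A⁻¹‖ * s ^ x.2) := by
              ring
          _ ≤ 1 * 1 := mul_le_mul (hA _) (ih _ hx2) (by positivity) zero_le_one
          _ = 1 := one_mul 1
      · simp

theorem tendsto_diskSup_zero (f : HInf K) :
    Tendsto (fun s => diskSup 0 s f) (𝓝[<] 1) (𝓝 (supNorm f)) := by
  refine tendsto_order.2 ⟨fun a ha => ?_, fun a ha => ?_⟩
  · obtain ⟨x, hx⟩ := exists_lt_of_lt_ciSup ha
    filter_upwards [Ioo_mem_nhdsLT x.norm_lt_one] with s hs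
    exact hx.trans_le (norm_le_diskSup f (by simpa using hs.1.le))
  · filter_upwards [Ioo_mem_nhdsLT (zero_lt_one (α := ℝ))] with s hs
    exact (diskSup_le_supNorm f 0 hs.1.le).trans_lt ha

theorem norm_eval_zero_multiset_prod (V : Multiset K) :
    ‖(V.map fun v => X - C v).prod.eval 0‖ = (V.map fun v => ‖v‖).prod := by
  induction V using Multiset.induction with
  | empty => simp
  | cons v V ih => rw [Multiset.map_cons, Multiset.prod_cons, eval_mul, norm_mul, ih]; simp

/-- The local factor: if `ψ(f) < L ‖f‖` and `ψ(z - w) = 1` for `w` in the disk, then dividing `f`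
approximately by its zeros in `|z| ≤ s`, `s` close to `1`, gives a function without zeros there;
normalized to have constant coefficient `1` it has norm close to `1` and `ψ`-value at most about
`L`, and so has its product `G` with a Taylor polynomial of its inverse. -/
theorem exists_factor (ψ : Berkovich K)
    (hψ : ∀ w : K, ‖w‖ < 1 → ψ (coord K - algebraMap K (HInf K) w) = 1) {f : HInf K} (hf : f ≠ 0)
    {L B : ℝ} (hL : ψ f < L * supNorm f) (hB : 1 < B) (l : ℕ) :
    ∃ G : HInf K, PowerSeries.X ^ l ∣ toPS K G - 1 ∧ supNorm G ≤ B ∧ ψ G ≤ L := by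
  have hf0 := supNorm_pos hf
  have hlim : Tendsto (fun s : ℝ => s ^ l * diskSup 0 s f) (𝓝[<] 1) (𝓝 (supNorm f)) := by
    have := ((continuous_pow (M := ℝ) l).tendsto 1).mono_left
      (nhdsWithin_le_nhds (s := Set.Iio (1 : ℝ)))
    simpa using this.mul (tendsto_diskSup_zero f)
  have hL0 : 0 < L := by
    by_contra! h
    have := apply_nonneg ψ f
    nlinarith
  obtain ⟨s, ⟨⟨hsB, hsL⟩, hspos⟩, hs0, hs1⟩ :=
    ((((hlim.const_mul B).eventually (lt_mem_nhds (lt_mul_of_one_lt_left hf0 hB))).and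
    ((hlim.const_mul L).eventually (lt_mem_nhds hL))).and
    ((tendsto_diskSup_zero f).eventually (lt_mem_nhds hf0))).and
    (Ioo_mem_nhdsLT (zero_lt_one (α := ℝ))) |>.exists
  obtain ⟨m, hm⟩ : ∃ m, m = diskSup 0 s f := ⟨_, rfl⟩
  rw [← hm] at hsB hsL hspos
  have hmf : m ≤ supNorm f := hm ▸ diskSup_le_supNorm f 0 hs0.le
  -- `η` bounds the remainder and the quotient of the division below; at most `‖f‖ / m` is lost in
  -- it, so an approximation of `f` up to `δ = η m / ‖f‖` suffices.
  obtain ⟨η, hη⟩ : ∃ η, η = min (m / 2) (L * (s ^ l * m) - ψ f) := ⟨_, rfl⟩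
  have hη0 : 0 < η := hη ▸ lt_min (half_pos hspos) (sub_pos.2 hsL)
  have hηm : η < m := (hη ▸ min_le_left _ _ : η ≤ m / 2).trans_lt (half_lt_self hspos)
  have hηL : ψ f + η ≤ L * (s ^ l * m) := by
    have : η ≤ L * (s ^ l * m) - ψ f := hη ▸ min_le_right _ _
    linarith
  obtain ⟨δ, hδ⟩ : ∃ δ, δ = η * m / supNorm f := ⟨_, rfl⟩
  have hδ0 : 0 < δ := by rw [hδ]; positivity
  have hδη : δ ≤ η := by
    rw [hδ, div_le_iff₀ hf0]
    gcongr
  obtain ⟨p, hp, hpf⟩ := exists_polynomial_approx f hs1 hδ0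
  have hpδ : diskSup 0 s (f - polyH K p) ≤ δ :=
    diskSup_le hs0.le fun z hz => hp z (by simpa using hz)
  have hps : rootSup p 0 s = m := by
    rw [hm, ← Disk.coe_zero (K := K), ← diskSup_polyH p 0 hs0 hs1]
    exact diskSup_eq_of_sub_lt hs0.le (hm ▸ hpδ.trans_lt (hδη.trans_lt hηm))
  have hp1 := rootSup_zero_one_le p hpf
  -- `W` are the roots to divide by, `V` the others, and `κ = |c ∏ v|` is the value at `0` of the
  -- cofactor.
  set W := p.roots.filter fun w => ‖w‖ ≤ s with hWdef
  set V := p.roots.filter fun w => ¬ ‖w‖ ≤ s with hVdef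
  have hroots : p.roots = W + V := (Multiset.filter_add_not _ _).symm
  have hW : ∀ w ∈ W, ‖w‖ ≤ s := fun w hw => (Multiset.mem_filter.1 hw).2
  have hV : ∀ v ∈ V, s < ‖v‖ := fun v hv => not_le.1 (Multiset.mem_filter.1 hv).2
  set Q : K[X] := (V.map fun v => X - C v).prod with hQdef
  have hpQ : p = (W.map fun w => X - C w).prod * (C p.leadingCoeff * Q) := by
    conv_lhs => rw [(IsAlgClosed.splits p).eq_prod_roots, hroots, Multiset.map_add,
      Multiset.prod_add]
    ring
  obtain ⟨κ, hκ⟩ : ∃ κ, κ = ‖p.leadingCoeff‖ * (V.map fun v => ‖v‖).prod := ⟨_, rfl⟩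
  have hVs : (V.map fun v => max s ‖v‖).prod = (V.map fun v => ‖v‖).prod := by
    rw [Multiset.map_congr rfl fun v hv => max_eq_right (hV v hv).le]
  have hκm : κ * s ^ W.card = m := by
    rw [← hps, rootSup, hroots]
    simp only [zero_sub, norm_neg, Multiset.map_add, Multiset.prod_add]
    rw [hVs, Multiset.map_congr (s := W) rfl fun w hw => max_eq_left (hW w hw),
      Multiset.map_const', Multiset.prod_replicate, hκ]
    ring
  have hp1' : ‖p.leadingCoeff‖ * (V.map fun v => max 1 ‖v‖).prod ≤ supNorm f := by
    refine le_trans (le_of_eq ?_) hp1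
    rw [rootSup, hroots]
    simp only [zero_sub, norm_neg, Multiset.map_add, Multiset.prod_add]
    rw [Multiset.map_congr (s := W) rfl fun w hw => max_eq_left ((hW w hw).trans hs1.le)]
    simp
  have hκf : κ ≤ supNorm f := by
    refine le_trans ?_ hp1'
    rw [hκ]
    exact mul_le_mul_of_nonneg_left (Multiset.prod_map_le_prod_map₀ _ _
      (fun _ _ => norm_nonneg _) fun _ _ => le_max_right _ _) (norm_nonneg _)
  have hsW : 0 < s ^ W.card := by positivity
  have hmκ : m ≤ κ := by
    rw [← hκm]
    refine mul_le_of_le_one_right ?_ (pow_le_one₀ hs0.le hs1.le)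
    by_contra! h
    nlinarith
  have hκ0 : 0 < κ := hspos.trans_le hmκ
  have hδW : ∀ x : ℝ, x * s ^ W.card ≤ δ → x ≤ η := fun x hx => by
    have h1 : m ≤ supNorm f * s ^ W.card := by rw [← hκm]; gcongr
    have h2 : δ ≤ η * s ^ W.card := by
      rw [hδ, div_le_iff₀ hf0]
      calc η * m ≤ η * (supNorm f * s ^ W.card) := by gcongr
        _ = _ := by ring
    exact le_of_mul_le_mul_right (hx.trans h2) hsW
  obtain ⟨q, R, hqR, hR, hq, hq'⟩ := exists_eq_polyH_mul_add W hs0 hs1 hW (f - polyH K p)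
  replace hR := hδW _ (hR.trans hpδ)
  replace hq := hδW _ (hq.trans hpδ)
  have hqf : supNorm q ≤ supNorm f := by
    refine hq'.trans (supNorm_le_of_coeff _ fun i => ?_)
    rw [map_sub, toPS_polyH, map_sub, coeff_coe]
    exact (norm_sub_le_max' _ _).trans (max_le (norm_coeff_le_supNorm f i) (hpf i))
  set u : HInf K := polyH K (C p.leadingCoeff * Q) + q with hu
  have hfu : f = polyH K (W.map fun w => X - C w).prod * u + R := by
    have h1 : f = polyH K p + (f - polyH K p) := by ring
    rw [hqR] at h1
    rw [h1, hu]
    conv_lhs => rw [hpQ]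
    rw [map_mul]
    ring
  have hψW : ψ (polyH K (W.map fun w => X - C w).prod) = 1 := by
    rw [map_multiset_prod, map_multiset_prod, Multiset.map_map, Multiset.map_map]
    refine Multiset.prod_eq_one fun x hx => ?_
    obtain ⟨w, hw, rfl⟩ := Multiset.mem_map.1 hx
    simp only [Function.comp_apply, polyH_X_sub_C]
    exact hψ w ((hW w hw).trans_lt hs1)
  have hψu : ψ u ≤ L * (s ^ l * m) := by
    have h1 : polyH K (W.map fun w => X - C w).prod * u = f + -R := by
      rw [eq_comm, ← sub_eq_add_neg, sub_eq_iff_eq_add]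
      exact hfu
    have h2 : ψ u = ψ (f + -R) := by rw [← h1, map_mul, hψW, one_mul]
    rw [h2]
    refine (map_add_le_add ψ f (-R)).trans (le_trans ?_ hηL)
    rw [map_neg_eq_map]
    gcongr
    exact (ψ.le_supNorm R).trans hR
  have hucoeff : ∀ i, PowerSeries.coeff i (toPS K u) =
      p.leadingCoeff * Q.coeff i + PowerSeries.coeff i (toPS K q) := fun i => by
    rw [hu, map_add, toPS_polyH, map_add, coeff_coe, coeff_C_mul]
  have hu1 : ∀ i, ‖PowerSeries.coeff i (toPS K u)‖ ≤ supNorm f := fun i => by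
    rw [hucoeff]
    refine (IsUltrametricDist.norm_add_le_max _ _).trans
      (max_le ?_ ((norm_coeff_le_supNorm q i).trans hqf))
    have h1 := norm_coeff_multiset_prod_mul_pow_le V zero_le_one i
    rw [one_pow, mul_one] at h1
    rw [norm_mul]
    exact (mul_le_mul_of_nonneg_left h1 (norm_nonneg _)).trans hp1'
  have hus : ∀ i, ‖PowerSeries.coeff i (toPS K u)‖ * s ^ i ≤ κ := fun i => by
    rw [hucoeff]
    refine (mul_le_mul_of_nonneg_right (IsUltrametricDist.norm_add_le_max _ _)
      (by positivity)).trans ?_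
    rw [max_mul_of_nonneg _ _ (by positivity)]
    refine max_le ?_ ((norm_coeff_mul_pow_le_diskSup q hs0 hs1 i).trans
      (hq.trans (hηm.le.trans hmκ)))
    rw [norm_mul, mul_assoc, hκ, ← hVs]
    exact mul_le_mul_of_nonneg_left (norm_coeff_multiset_prod_mul_pow_le V hs0.le i)
      (norm_nonneg _)
  obtain ⟨b, hb⟩ : ∃ b, b = PowerSeries.constantCoeff (toPS K u) := ⟨_, rfl⟩
  have hbκ : ‖b‖ = κ := by
    have h1 : ‖p.leadingCoeff * Q.coeff 0‖ = κ := by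
      rw [norm_mul, hκ, coeff_zero_eq_eval_zero, norm_eval_zero_multiset_prod]
    have h2 : ‖PowerSeries.coeff 0 (toPS K q)‖ < κ := by
      have := norm_coeff_mul_pow_le_diskSup q hs0 hs1 0
      rw [pow_zero, mul_one] at this
      exact this.trans_lt (hq.trans_lt (hηm.trans_le hmκ))
    rw [hb, ← PowerSeries.coeff_zero_eq_constantCoeff_apply, hucoeff,
      IsUltrametricDist.norm_add_eq_max_of_norm_ne_norm (by rw [h1]; exact h2.ne'), h1,
      max_eq_left h2.le]
  have hb0 : b ≠ 0 := norm_pos_iff.1 (hbκ ▸ hκ0)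
  obtain ⟨v, hv⟩ : ∃ v : HInf K, v = algebraMap K (HInf K) b⁻¹ * u := ⟨_, rfl⟩
  have hvcoeff : ∀ i, ‖PowerSeries.coeff i (toPS K v)‖ =
      κ⁻¹ * ‖PowerSeries.coeff i (toPS K u)‖ := fun i => by
    rw [hv, map_mul, toPS_algebraMap, PowerSeries.coeff_C_mul, norm_mul, norm_inv, hbκ]
  have hvsup : supNorm v ≤ supNorm f / m := by
    refine supNorm_le_of_coeff v fun i => ?_
    rw [hvcoeff, div_eq_inv_mul]
    exact mul_le_mul (inv_anti₀ hspos hmκ) (hu1 i) (norm_nonneg _) (by positivity)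
  have hψv : ψ v ≤ L * s ^ l := by
    rw [hv, map_mul]
    have h1 : ψ (algebraMap K (HInf K) b⁻¹) ≤ m⁻¹ := by
      refine ((ψ.le_supNorm _).trans (supNorm_algebraMap_le _)).trans ?_
      rw [norm_inv, hbκ]
      exact inv_anti₀ hspos hmκ
    calc _ ≤ m⁻¹ * (L * (s ^ l * m)) := mul_le_mul h1 hψu (apply_nonneg _ _) (by positivity)
      _ = L * s ^ l := by field_simp
  set A := toPS K v with hA
  have hA0 : PowerSeries.constantCoeff A = 1 := by
    rw [hA, hv, map_mul, toPS_algebraMap, map_mul, PowerSeries.constantCoeff_C, ← hb,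
      inv_mul_cancel₀ hb0]
  have hAs : ∀ i, ‖PowerSeries.coeff i A‖ * s ^ i ≤ 1 := fun i => by
    rw [hvcoeff, mul_assoc, inv_mul_le_iff₀ hκ0, mul_one]
    exact hus i
  have hI := norm_coeff_inv_mul_pow_le hA0 hs0.le hAs
  set T := A⁻¹.trunc l with hT
  have hTsup : supNorm (polyH K T) ≤ (s ^ l)⁻¹ := by
    refine supNorm_le_of_coeff _ fun i => ?_
    rw [toPS_polyH, coeff_coe, hT, PowerSeries.coeff_trunc]
    split_ifs with hil
    · have h1 : ‖PowerSeries.coeff i A⁻¹‖ ≤ (s ^ i)⁻¹ := by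
        rw [← one_div, le_div_iff₀ (by positivity)]
        exact hI i
      exact h1.trans (inv_anti₀ (by positivity) (pow_le_pow_of_le_one hs0.le hs1.le hil.le))
    · rw [norm_zero]; positivity
  refine ⟨v * polyH K T, ?_, ?_, ?_⟩
  · have h1 : A * A⁻¹ = 1 := PowerSeries.mul_inv_cancel A (by rw [hA0]; exact one_ne_zero)
    rw [map_mul, toPS_polyH, ← h1, ← mul_sub]
    refine Dvd.dvd.mul_left (PowerSeries.X_pow_dvd_iff.2 fun i hi => ?_) _
    rw [map_sub, coeff_coe, hT, PowerSeries.coeff_trunc, if_pos hi, sub_self]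
  · refine (supNorm_mul_le _ _).trans ((mul_le_mul hvsup hTsup (supNorm_nonneg _)
      (by positivity)).trans ?_)
    rw [← div_eq_mul_inv, div_div, div_le_iff₀ (by positivity)]
    calc supNorm f ≤ B * (s ^ l * m) := hsB.le
      _ = B * (m * s ^ l) := by ring
  · rw [map_mul]
    calc ψ v * ψ (polyH K T) ≤ L * s ^ l * (s ^ l)⁻¹ :=
          mul_le_mul hψv ((ψ.le_supNorm _).trans hTsup) (apply_nonneg _ _) (by positivity)
      _ = L := by field_simp

end Division

/-! ### Infinite products, kernels and the chain of type IV points -/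

section InfiniteProduct

variable {K : Type*} [NontriviallyNormedField K] [IsUltrametricDist K] [IsAlgClosed K]
  [CompleteSpace K]

theorem X_pow_dvd_prod_Ico_sub {G : ℕ → PowerSeries K}
    (hG : ∀ j, PowerSeries.X ^ (j + 1) ∣ G j - 1) {J M N : ℕ} (hJM : J ≤ M) (hMN : M ≤ N) :
    PowerSeries.X ^ (M + 1) ∣ ∏ j ∈ Finset.Ico J N, G j - ∏ j ∈ Finset.Ico J M, G j := by
  induction N, hMN using Nat.le_induction with
  | base => simp
  | succ N hMN ih =>
    rw [Finset.prod_Ico_succ_top (hJM.trans hMN)]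
    have e : (∏ j ∈ Finset.Ico J N, G j) * G N - ∏ j ∈ Finset.Ico J M, G j =
        (∏ j ∈ Finset.Ico J N, G j) * (G N - 1) +
          (∏ j ∈ Finset.Ico J N, G j - ∏ j ∈ Finset.Ico J M, G j) := by ring
    rw [e]
    exact dvd_add (Dvd.dvd.mul_left ((pow_dvd_pow _ (by omega)).trans (hG N)) _) ih

/-- An infinite product of functions `Gⱼ = 1 + O(z^(j+1))` converges coefficientwise, and its norm
and those of its tails are bounded if `‖Gⱼ‖ ≤ b (j+1) / b j` with `b` bounded. -/
theorem exists_infinite_prod {G : ℕ → HInf K}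
    (hG : ∀ j, PowerSeries.X ^ (j + 1) ∣ toPS K (G j) - 1) {b : ℕ → ℝ} {C : ℝ}
    (hb : ∀ j, 1 ≤ b j) (hbC : ∀ j, b j ≤ C) (hGb : ∀ j, supNorm (G j) ≤ b (j + 1) / b j) :
    ∃ g : HInf K, g ≠ 0 ∧ ∀ J, ∃ H : HInf K,
      g = (∏ j ∈ Finset.range J, G j) * H ∧ supNorm H ≤ C := by
  have hC : 1 ≤ C := (hb 0).trans (hbC 0)
  have hprod : ∀ J M, J ≤ M → supNorm (∏ j ∈ Finset.Ico J M, G j) ≤ b M / b J := by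
    intro J M hJM
    induction M, hJM using Nat.le_induction with
    | base => simpa [div_self (zero_lt_one.trans_le (hb J)).ne'] using supNorm_one_le (K := K)
    | succ M hJM ih =>
      have h1 := zero_lt_one.trans_le (hb M)
      have h2 := zero_lt_one.trans_le (hb J)
      rw [Finset.prod_Ico_succ_top hJM]
      calc _ ≤ b M / b J * (b (M + 1) / b M) := (supNorm_mul_le _ _).trans
            (mul_le_mul ih (hGb M) (supNorm_nonneg _) (by positivity))
        _ = _ := by field_simp
  have hprodC : ∀ J M, supNorm (∏ j ∈ Finset.Ico J M, G j) ≤ C := by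
    intro J M
    rcases le_total J M with h | h
    · refine (hprod J M h).trans ((div_le_self (zero_le_one.trans (hb M)) (hb J)).trans (hbC M))
    · rw [Finset.Ico_eq_empty_of_le h, Finset.prod_empty]
      exact supNorm_one_le.trans hC
  set P : ℕ → ℕ → PowerSeries K := fun J M => ∏ j ∈ Finset.Ico J M, toPS K (G j) with hP
  have hPG : ∀ J M, P J M = toPS K (∏ j ∈ Finset.Ico J M, G j) := fun J M => by
    rw [hP, map_prod]
  -- the tail product `∏_{j ≥ J} Gⱼ`
  have htail : ∀ J, ∃ H : HInf K, supNorm H ≤ C ∧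
      ∀ M, J ≤ M → PowerSeries.X ^ (M + 1) ∣ toPS K H - P J M := by
    intro J
    have hcoeff : ∀ i, ‖PowerSeries.coeff i (PowerSeries.mk fun i =>
        PowerSeries.coeff i (P J (J + i)))‖ ≤ C := fun i => by
      rw [PowerSeries.coeff_mk, hPG]
      exact (norm_coeff_le_supNorm _ i).trans (hprodC _ _)
    obtain ⟨H, hH⟩ := exists_toPS_eq _ hcoeff
    refine ⟨H, supNorm_le_of_coeff H (by rw [hH]; exact hcoeff), fun M hM => ?_⟩
    refine PowerSeries.X_pow_dvd_iff.2 fun i hi => ?_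
    rw [hH, map_sub, PowerSeries.coeff_mk]
    rcases le_total (J + i) M with h | h
    · have := PowerSeries.X_pow_dvd_iff.1 (X_pow_dvd_prod_Ico_sub hG (Nat.le_add_right J i) h) i
        (by omega)
      rw [map_sub, sub_eq_zero] at this
      rw [sub_eq_zero]; exact this.symm
    · have := PowerSeries.X_pow_dvd_iff.1 (X_pow_dvd_prod_Ico_sub hG hM h) i hi
      rwa [map_sub] at this
  choose H hHC hH using htail
  refine ⟨H 0, fun h0 => ?_, fun J => ⟨H J, toPS_injective ?_, hHC J⟩⟩
  · have := PowerSeries.X_pow_dvd_iff.1 (hH 0 0 le_rfl) 0 (by simp)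
    simp [h0, hP] at this
  · rw [← sub_eq_zero, map_mul]
    ext i
    have hM := le_max_left J i
    have e : toPS K (H 0) - toPS K (∏ j ∈ Finset.range J, G j) * toPS K (H J) =
        (toPS K (H 0) - P 0 (max J i)) - P 0 J * (toPS K (H J) - P J (max J i)) := by
      have h1 : P 0 (max J i) = P 0 J * P J (max J i) :=
        (Finset.prod_Ico_consecutive _ (Nat.zero_le J) hM).symm
      rw [h1, hPG 0 J, Finset.range_eq_Ico]
      ring
    rw [e, map_zero]
    exact PowerSeries.X_pow_dvd_iff.1 (dvd_sub (hH 0 _ (Nat.zero_le _))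
      (Dvd.dvd.mul_left (hH J _ hM) _)) i (Nat.lt_succ_of_le (le_max_right J i))

/-- An increasing sequence in `[1, 2)`. -/
def growth (j : ℕ) : ℝ := 2 - 1 / (j + 1)

theorem one_le_growth (j : ℕ) : 1 ≤ growth j := by
  have : (1 : ℝ) / (j + 1) ≤ 1 := by
    rw [div_le_one (by positivity)]
    linarith [(Nat.cast_nonneg j : (0 : ℝ) ≤ j)]
  unfold growth
  linarith

theorem growth_le_two (j : ℕ) : growth j ≤ 2 := by
  have : (0 : ℝ) ≤ 1 / (j + 1) := by positivity
  unfold growth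
  linarith

theorem one_lt_growth_div (j : ℕ) : 1 < growth (j + 1) / growth j := by
  rw [one_lt_div (zero_lt_one.trans_le (one_le_growth j))]
  unfold growth
  have : (1 : ℝ) / ((j + 1 : ℕ) + 1) < 1 / (j + 1) :=
    one_div_lt_one_div_of_lt (by positivity) (by push_cast; linarith)
  linarith

/-- A point of the Berkovich space at the boundary of the disk whose value at some `f` is smaller
than `‖f‖` kills a nonzero function, the product of the local factors of `exists_factor`. -/
theorem ker_ne_bot_of_lt_supNorm (ψ : Berkovich K)
    (hψ : ∀ w : K, ‖w‖ < 1 → ψ (coord K - algebraMap K (HInf K) w) = 1) {f : HInf K}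
    (hlt : ψ f < supNorm f) : ψ.ker ≠ ⊥ := by
  have hf : f ≠ 0 := fun h => by
    have h1 : supNorm f ≤ 0 := supNorm_le fun z => by rw [h]; exact norm_zero.le
    linarith [apply_nonneg ψ f]
  have hf0 := supNorm_pos hf
  obtain ⟨L, hL1, hL2⟩ := exists_between ((div_lt_one hf0).2 hlt)
  rw [div_lt_iff₀ hf0] at hL1
  have hex := fun j : ℕ => exists_factor ψ hψ hf hL1 (one_lt_growth_div j) (j + 1)
  choose G hG hGb hGL using hex
  obtain ⟨g, hg0, hg⟩ := exists_infinite_prod hG one_le_growth growth_le_two hGb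
  have hL0 : 0 ≤ L := (apply_nonneg ψ _).trans (hGL 0)
  have hbound : ∀ J : ℕ, ψ g ≤ L ^ J * 2 := fun J => by
    obtain ⟨H, hH, hH2⟩ := hg J
    rw [hH, map_mul, map_prod]
    refine mul_le_mul ?_ ((ψ.le_supNorm H).trans hH2) (apply_nonneg _ _) (by positivity)
    calc _ ≤ ∏ j ∈ Finset.range J, L :=
          Finset.prod_le_prod (fun _ _ => apply_nonneg _ _) fun j _ => hGL j
      _ = L ^ J := by simp
  have hzero : ψ g ≤ 0 := by
    refine ge_of_tendsto' (x := atTop) ?_ hbound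
    simpa using (tendsto_pow_atTop_nhds_zero_of_lt_one hL0 hL2).mul_const 2
  intro hbot
  have : g ∈ ψ.ker := le_antisymm hzero (apply_nonneg _ _)
  rw [hbot] at this
  exact hg0 this

theorem apply_coord_sub_of_mem_M₀ {ψ : Berkovich K} (hψ : ψ ∈ M₀ K) {w : K} (hw : ‖w‖ < 1) :
    ψ (coord K - algebraMap K (HInf K) w) = 1 := by
  obtain ⟨F, z, r, hnp, hz, hr, hlim⟩ := hψ
  have hzF := hz.mono_left hnp.le_atTop
  have hle : ψ (coord K - algebraMap K (HInf K) w) ≤ 1 :=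
    (ψ.le_supNorm _).trans (supNorm_coord_sub_le hw.le)
  refine le_antisymm hle (le_of_tendsto_of_tendsto hzF (hlim _) ?_)
  filter_upwards [hzF.eventually (lt_mem_nhds hw)] with n hn
  have h1 : ‖(z n : K) - w‖ = ‖(z n : K)‖ := by
    rw [sub_eq_add_neg, IsUltrametricDist.norm_add_eq_max_of_norm_ne_norm]
    · rw [norm_neg]; exact max_eq_left hn.le
    · rw [norm_neg]; exact hn.ne'
  rw [← h1]
  exact norm_le_diskSup (coord K - algebraMap K (HInf K) w) (by simpa using (hr n).1.le)

theorem M₁_subset_M₀ : M₁ K ⊆ M₀ K := fun _ ⟨F, z, r, h, _⟩ => ⟨F, z, r, h⟩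

theorem Berkovich.ker_ne_top (φ : Berkovich K) : φ.ker ≠ ⊤ := fun h => by
  have h1 : φ 1 = 0 := Berkovich.mem_ker.1 (h ▸ Submodule.mem_top)
  rw [map_one] at h1
  exact one_ne_zero h1

theorem Berkovich.ker_isPrime (φ : Berkovich K) : φ.ker.IsPrime :=
  ⟨φ.ker_ne_top, fun {f g} h => by
    rw [mem_ker, map_mul] at h
    exact mul_eq_zero.1 h⟩

theorem exists_isTypeIV_above {φ : Berkovich K} (hφ : φ ∈ M₀ K) {f : HInf K} (hf : f ∈ φ.ker)
    {ρ : ℝ} (hρ : ρ ∈ Set.Ioo 0 (supNorm f)) :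
    ∃ ψ ∈ M₁ K, ψ.IsTypeIV ∧ (∀ g : HInf K, φ g ≤ ψ g) ∧ ψ f = ρ ∧ ψ.ker < φ.ker := by
  obtain ⟨F, z, r, h⟩ := hφ
  obtain ⟨ψ, hψ, hle, hψf⟩ := exists_mem_M₁_of_isDiskLimit h hf hρ.1 hρ.2
  have hker : ψ.ker < φ.ker := by
    refine lt_of_le_of_ne (fun g hg => ?_) fun heq => ?_
    · exact le_antisymm ((hle g).trans (Berkovich.mem_ker.1 hg).le) (apply_nonneg φ g)
    · rw [← heq, Berkovich.mem_ker, hψf] at hf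
      exact hρ.1.ne' hf
  refine ⟨ψ, hψ, ⟨ψ.ker_isPrime, ?_, fun hmax => ?_⟩, hle, hψf, hker⟩
  · exact ker_ne_bot_of_lt_supNorm ψ (fun w hw => apply_coord_sub_of_mem_M₀ (M₁_subset_M₀ hψ) hw)
      (hψf ▸ hρ.2)
  · exact φ.ker_ne_top (hmax.out.2 _ hker)

theorem exists_isTypeIV_ker_lt {φ : Berkovich K} (hφ : φ ∈ M₀ K) (hker : φ.ker ≠ ⊥) :
    ∃ ψ ∈ M₁ K, ψ.IsTypeIV ∧ ψ.ker < φ.ker := by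
  obtain ⟨f, hf, hf0⟩ := Submodule.exists_mem_ne_zero_of_ne_bot hker
  have hpos := supNorm_pos hf0
  obtain ⟨ψ, hψ, h4, _, _, hlt⟩ := exists_isTypeIV_above hφ hf ⟨half_pos hpos, half_lt_self hpos⟩
  exact ⟨ψ, hψ, h4, hlt⟩

theorem exists_strictAnti_ker {φ : Berkovich K} (hφ : φ ∈ M₀ K) (hker : φ.ker ≠ ⊥) :
    ∃ ψ : ℕ → Berkovich K, ψ 0 = φ ∧ (∀ n, ψ (n + 1) ∈ M₁ K ∧ (ψ (n + 1)).IsTypeIV) ∧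
      StrictAnti fun n => (ψ n).ker := by
  have hstep : ∀ x : {x : Berkovich K // x ∈ M₀ K ∧ x.ker ≠ ⊥},
      ∃ y : {x : Berkovich K // x ∈ M₀ K ∧ x.ker ≠ ⊥},
        (y.1 ∈ M₁ K ∧ y.1.IsTypeIV) ∧ y.1.ker < x.1.ker := fun x => by
    obtain ⟨ψ, hψ, h4, hlt⟩ := exists_isTypeIV_ker_lt x.2.1 x.2.2
    exact ⟨⟨ψ, M₁_subset_M₀ hψ, h4.2.1⟩, ⟨hψ, h4⟩, hlt⟩
  choose next hnext hlt using hstep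
  refine ⟨fun n => (next^[n] ⟨φ, hφ, hker⟩).1, rfl, fun n => ?_, strictAnti_nat_of_succ_lt fun n => ?_⟩
  · simp only [Function.iterate_succ_apply']
    exact hnext _
  · simp only [Function.iterate_succ_apply']
    exact hlt _

variable (K) in
/-- A nonzero bounded analytic function with zeros `wⱼ`, `|wⱼ| → 1`: the product of the factors
`1 - (z / wⱼ)^(j+1)`. -/
theorem exists_infinitely_many_zeros : ∃ (g : HInf K) (w : ℕ → Disk K), g ≠ 0 ∧
    (∀ n, (w n : K) ≠ 0) ∧ Tendsto (fun n => ‖(w n : K)‖) atTop (𝓝 1) ∧ ∀ n, g.1 (w n) = 0 := by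
  have hex : ∀ j : ℕ, ∃ w : K, (1 - 1 / ((j : ℝ) + 1) < ‖w‖ ∧ 0 < ‖w‖ ∧ ‖w‖ < 1) ∧
      1 < growth (j + 1) / growth j * ‖w‖ ^ (j + 1) := fun j => by
    have hlim : Tendsto (fun s : ℝ => growth (j + 1) / growth j * s ^ (j + 1)) (𝓝[<] 1)
        (𝓝 (growth (j + 1) / growth j * 1 ^ (j + 1))) :=
      ((continuous_const.mul (continuous_pow (j + 1))).tendsto 1).mono_left nhdsWithin_le_nhds
    rw [one_pow, mul_one] at hlim
    obtain ⟨a, ha, hsub⟩ := (mem_nhdsLT_iff_exists_Ioo_subset' zero_lt_one).1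
      (hlim.eventually (lt_mem_nhds (one_lt_growth_div j)))
    have hj : (1 : ℝ) - 1 / (j + 1) < 1 := by
      have : (0 : ℝ) < 1 / (j + 1) := by positivity
      linarith
    obtain ⟨w, hw1, hw2⟩ := exists_norm_mem_Ioo K (a := max a (max (1 - 1 / ((j : ℝ) + 1)) 0))
      ((le_max_right _ _).trans (le_max_right _ _)) (max_lt ha (max_lt hj one_pos))
    exact ⟨w, ⟨(le_max_left _ _).trans_lt ((le_max_right _ _).trans_lt hw1),
      (le_max_right _ _).trans_lt ((le_max_right _ _).trans_lt hw1), hw2⟩,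
      hsub ⟨(le_max_left _ _).trans_lt hw1, hw2⟩⟩
  choose w hw hwB using hex
  set G : ℕ → HInf K := fun j => polyH K (1 - C ((w j)⁻¹ ^ (j + 1)) * X ^ (j + 1)) with hG
  have hGdvd : ∀ j, PowerSeries.X ^ (j + 1) ∣ toPS K (G j) - 1 := fun j => by
    rw [hG, toPS_polyH]
    refine ⟨-PowerSeries.C ((w j)⁻¹ ^ (j + 1)), ?_⟩
    simp only [coe_sub, coe_one, coe_mul, coe_C, coe_pow, coe_X]
    ring
  have hGb : ∀ j, supNorm (G j) ≤ growth (j + 1) / growth j := fun j => by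
    refine supNorm_le fun z => ?_
    simp only [hG, polyH_apply, eval_sub, eval_one, eval_mul, eval_C, eval_pow, eval_X]
    refine (norm_sub_le_max' _ _).trans (max_le (norm_one.le.trans (one_lt_growth_div j).le) ?_)
    rw [norm_mul, norm_pow, norm_pow, norm_inv, inv_pow,
      inv_mul_le_iff₀ (pow_pos (hw j).2.1 _), mul_comm]
    exact (pow_le_one₀ (norm_nonneg _) z.norm_lt_one.le).trans (hwB j).le
  obtain ⟨g, hg0, hg⟩ := exists_infinite_prod hGdvd one_le_growth growth_le_two hGb
  refine ⟨g, fun j => Disk.mk (w j) (hw j).2.2, hg0, fun j => norm_pos_iff.1 (hw j).2.1, ?_,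
    fun j => ?_⟩
  · refine tendsto_of_tendsto_of_tendsto_of_le_of_le (g := fun j : ℕ => 1 - 1 / ((j : ℝ) + 1)) ?_
      tendsto_const_nhds (fun j => (hw j).1.le) fun j => (hw j).2.2.le
    simpa using (tendsto_one_div_add_atTop_nhds_zero_nat (𝕜 := ℝ)).const_sub 1
  · obtain ⟨H, hH, _⟩ := hg (j + 1)
    rw [Finset.prod_range_succ] at hH
    rw [hH]
    have h0 : (G j).1 (Disk.mk (w j) (hw j).2.2) = 0 := by
      have hw0 : w j ≠ 0 := norm_pos_iff.1 (hw j).2.1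
      simp only [hG, polyH_apply, eval_sub, eval_one, eval_mul, eval_C, eval_pow, eval_X,
        Disk.coe_mk]
      rw [← mul_pow, inv_mul_cancel₀ hw0, one_pow, sub_self]
    change (∏ j ∈ Finset.range j, G j).1 _ * (G j).1 _ * H.1 _ = 0
    rw [h0, mul_zero, zero_mul]

theorem diskSup_le_mul_of_apply_eq_zero {g : HInf K} {w : Disk K} (hw0 : (w : K) ≠ 0)
    (hg : g.1 w = 0) {r : ℝ} (hr : 0 ≤ r) : diskSup w r g ≤ r * supNorm g := by
  obtain ⟨q, c, hq, _, _, hqg⟩ :=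
    exists_eq_coord_sub_mul_add g (norm_pos_iff.2 hw0) w.norm_lt_one le_rfl
  have happ : ∀ x : Disk K, g.1 x = ((x : K) - w) * q.1 x + c := fun x => by
    conv_lhs => rw [hq]
    rfl
  have hc : c = 0 := by simpa [hg] using (happ w).symm
  refine diskSup_le hr fun x hx => ?_
  rw [happ, hc, add_zero, norm_mul]
  exact mul_le_mul hx ((norm_le_supNorm q x).trans hqg) (norm_nonneg _) hr

variable (K) in
theorem exists_mem_M₀_ker_ne_bot : ∃ φ ∈ M₀ K, φ.ker ≠ ⊥ := by
  obtain ⟨g, w, hg0, hw0, hw1, hgw⟩ := exists_infinitely_many_zeros K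
  set r : ℕ → ℝ := fun n => 1 / ((n + 1 : ℕ) + 1) with hr
  have hr0 : ∀ n, r n ∈ Set.Ioo (0 : ℝ) 1 := fun n =>
    ⟨by simp only [hr]; positivity, by
      simp only [hr]
      rw [div_lt_one (by positivity)]
      push_cast
      linarith [(Nat.cast_nonneg n : (0 : ℝ) ≤ n)]⟩
  have hrlim : Tendsto r atTop (𝓝 0) :=
    (tendsto_one_div_add_atTop_nhds_zero_nat (𝕜 := ℝ)).comp (tendsto_add_atTop_nat 1)
  have hnp : Nonprincipal (hyperfilter ℕ) := fun n hn => by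
    have h1 : {n} ∈ hyperfilter ℕ := by rw [hn]; exact mem_pure.2 rfl
    exact (Set.finite_singleton n).notMem_hyperfilter h1
  obtain ⟨φ, hφ⟩ := exists_berkovich_tendsto (hyperfilter ℕ) w r hr0
  refine ⟨φ, ⟨hyperfilter ℕ, w, r, hnp, hw1, hr0, hφ⟩, fun hbot => hg0 ?_⟩
  have h0 : g ∈ φ.ker := by
    have hlim := (hrlim.mono_left hnp.le_atTop).mul_const (supNorm g)
    rw [zero_mul] at hlim
    exact le_antisymm (le_of_tendsto_of_tendsto' (hφ g) hlim fun n =>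
      diskSup_le_mul_of_apply_eq_zero (hw0 n) (hgw n) (hr0 n).1.le) (apply_nonneg _ _)
  rw [hbot] at h0
  exact h0

end InfiniteProduct

end HInfBerkovich
end

open HInfBerkovich
theorem theorem2p1 (K : Type*) [NontriviallyNormedField K] [IsUltrametricDist K]
    [CompleteSpace K] [IsAlgClosed K] :
    (∀ φ ∈ M₀ K, φ.ker ≠ ⊥ →
      (∀ f ∈ φ.ker, f ≠ 0 → ∀ r ∈ Set.Ioo (0 : ℝ) (supNorm f),
        ∃ ψ ∈ M₁ K, ψ.IsTypeIV ∧ (∀ g : HInf K, φ g ≤ ψ g) ∧ ψ f = r ∧ ψ.ker < φ.ker) ∧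
      ∃ ψ : ℕ → Berkovich K, ψ 0 = φ ∧ (∀ n, ψ (n + 1) ∈ M₁ K ∧ (ψ (n + 1)).IsTypeIV) ∧
        StrictAnti fun n => (ψ n).ker) ∧
    (∃ ψ : Berkovich K, ψ.IsTypeIV) ∧
    ∃ ψ : ℕ → Berkovich K, StrictAnti fun n => (ψ n).ker := by
  obtain ⟨φ₀, hφ₀, hker₀⟩ := exists_mem_M₀_ker_ne_bot K
  obtain ⟨ψ, _, hψ, hanti⟩ := exists_strictAnti_ker hφ₀ hker₀
  exact ⟨fun φ hφ hker => ⟨fun f hf _ r hr => exists_isTypeIV_above hφ hf hr,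
    exists_strictAnti_ker hφ hker⟩, ⟨ψ 1, (hψ 0).2⟩, ψ, hanti⟩
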